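/- Fix a complete separable metric space $\Xi$. A network is a connected, locally finite multigraph $G$ with marks in $\Xi$ on its vertices and on its pairs (vertex, incident edge). Isomorphisms preserve marks. Let $\mathcal G$, $\mathcal G_*$, $\mathcal G_{**}$ be the sets of isomorphism classes $[G]$, $[G,o]$, $[G,o,v]$ of networks with no root, one root and two roots. Give $\mathcal G_*$ and $\mathcal G_{**}$ the Borel $\sigma$-fields of the local topology (two rooted networks are close if large balls around the roots are isomorphic with close marks), and give $\mathcal G$ the $\sigma$-field of all $B$ such that $\{[G,o]:[G]\in B\}$ is measurable. A random rooted network is a random element $[\boldsymbol G,\boldsymbol o]$ of $\mathcal G_*$; it is unimodular if $\mathbb E\sum_{v\in V(\boldsymbol G)} g[\boldsymbol G,\boldsymbol o,v]=\mathbb E\sum_{v\in V(\boldsymbol G)} g[\boldsymbol G,v,\boldsymbol o]$ for every measurable $g:\mathcal G_{**}\to[0,\infty)$. A unimodularization of $[\boldsymbol G]$ is a unimodular $[\boldsymbol G',\boldsymbol o']$ such that the laws of $[\boldsymbol G']$ and $[\boldsymbol G]$ on $\mathcal G$ are mutually absolutely continuous (this is also called a weak unimodularization). A covariant subset $S$ assigns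 to each network $G$ a set $S_G\subseteq V(G)$, compatibly with isomorphisms, such that $\{[G,o]:o\in S_G\}$ is measurable; the subnetwork induced by $S_G$ is also denoted by $S_G$. A proper extension of a unimodular network $[\boldsymbol G_0,\boldsymbol o_0]$, whose mark space may be a complete subspace of $\Xi$, is a pair $([\boldsymbol G,\boldsymbol o],S)$ of a random rooted network and a covariant subset such that almost surely $\boldsymbol o\in S_{\boldsymbol G}$ and $S_{\boldsymbol G}$ is connected, $[S_{\boldsymbol G},\boldsymbol o]$ has the same law as $[\boldsymbol G_0,\boldsymbol o_0]$, and $$\mathbb E\sum_{v\in S_{\boldsymbol G}} g[\boldsymbol G,\boldsymbol o,v]=\mathbb E\sum_{v\in S_{\boldsymbol G}} g[\boldsymbol G,v,\boldsymbol o]\qquad\text{for all measurable } g:\mathcal G_{**}\to[0,\infty).$$ **Proposition.** Let $([\boldsymbol G,\boldsymbol o],S)$ be a proper extension of a unimodular network. (i) There is at most one (law of a) unimodularization $[\boldsymbol G',\boldsymbol o']$ of $[\boldsymbol G]$ such that $\mathbb P[\boldsymbol o'\in S_{\boldsymbol G'}]>0$ and $[\boldsymbol G',\boldsymbol o']$ conditioned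 on $\boldsymbol o'\in S_{\boldsymbol G'}$ has the same law as $[\boldsymbol G,\boldsymbol o]$. (ii) Let $T:\mathcal G_{**}\to[0,\infty)$ be measurable such that almost surely, for all $v\in V(\boldsymbol G)$, $\sum_{w\in V(\boldsymbol G)}T[\boldsymbol G,v,w]=1$ and $T[\boldsymbol G,v,w]=0$ for all $w\in V(\boldsymbol G)\setminus S_{\boldsymbol G}$. Let $M:=\sum_{v\in V(\boldsymbol G)}T[\boldsymbol G,v,\boldsymbol o]$. Then a unimodularization as in (i) exists if and only if $\mathbb E[M]<\infty$, and in this case it is given by the probability measure $$\mathcal P_T[A]=\frac1{\mathbb E[M]}\,\mathbb E\Big[\sum_{v\in V(\boldsymbol G)}T[\boldsymbol G,v,\boldsymbol o]\,1_A[\boldsymbol G,v]\Big],\qquad A\subseteq\mathcal G_*\text{ measurable}.$$ -/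

import Mathlib

open MeasureTheory ProbabilityTheory TopologicalSpace
open scoped ENNReal NNReal

noncomputable section

/-- A locally finite marked multigraph, not necessarily connected. `ends e` is the unordered pair
of endpoints of the edge `e` (loops and multiple edges are allowed); marks are carried by the
vertices and by the pairs (vertex, incident edge). -/
structure PreNetwork (Ξ : Type*) where
  V : Type
  E : Type
  ends : E → Sym2 V
  vertexMark : V → Ξ
  edgeMark : (v : V) → (e : E) → v ∈ ends e → Ξ
  locallyFinite : ∀ v, {e | v ∈ ends e}.Finite

namespace PreNetwork

variable {Ξ Ξ' : Type*}

/-- The adjacency graph of a network; its distance `graph.dist` is the graph-distance. -/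
def graph (N : PreNetwork Ξ) : SimpleGraph N.V :=
  SimpleGraph.fromEdgeSet (Set.range N.ends)

/-- The subnetwork induced by a set of vertices. -/
def induce (N : PreNetwork Ξ) (s : Set N.V) : PreNetwork Ξ where
  V := {v // v ∈ s}
  E := {e : N.E // ∀ v ∈ N.ends e, v ∈ s}
  ends e := (N.ends e.1).attachWith e.2
  vertexMark v := N.vertexMark v.1
  edgeMark v e h := N.edgeMark v.1 e.1 (by
    have h' := (Sym2.mem_map (f := Subtype.val)).2 ⟨v, h, rfl⟩
    rwa [Sym2.attachWith_map_subtypeVal] at h')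
  locallyFinite v := by
    refine Set.Finite.subset ((N.locallyFinite v.1).preimage Subtype.val_injective.injOn) ?_
    intro e h
    have h' := (Sym2.mem_map (f := Subtype.val)).2 ⟨v, h, rfl⟩
    rwa [Sym2.attachWith_map_subtypeVal] at h'

/-- The same network with all marks transported by a map of mark spaces. -/
def mapMarks (ι : Ξ → Ξ') (N : PreNetwork Ξ) : PreNetwork Ξ' where
  V := N.V
  E := N.E
  ends := N.ends
  vertexMark v := ι (N.vertexMark v)
  edgeMark v e h := ι (N.edgeMark v e h)
  locallyFinite := N.locallyFinite

/-- An isomorphism of the underlying multigraphs, with no condition on the marks. -/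
structure GraphIso (N N' : PreNetwork Ξ) where
  toV : N.V ≃ N'.V
  toE : N.E ≃ N'.E
  inc : ∀ v e, v ∈ N.ends e ↔ toV v ∈ N'.ends (toE e)

/-- The isomorphism preserves all marks, i.e. it is an isomorphism of networks. -/
def GraphIso.PreservesMarks {N N' : PreNetwork Ξ} (φ : GraphIso N N') : Prop :=
  (∀ v, N'.vertexMark (φ.toV v) = N.vertexMark v) ∧
  ∀ v e (h : v ∈ N.ends e),
    N'.edgeMark (φ.toV v) (φ.toE e) ((φ.inc v e).1 h) = N.edgeMark v e h

/-- Corresponding marks are at distance less than `ε`. -/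
def GraphIso.MarksWithin [MetricSpace Ξ] {N N' : PreNetwork Ξ} (φ : GraphIso N N')
    (ε : ℝ) : Prop :=
  (∀ v, dist (N'.vertexMark (φ.toV v)) (N.vertexMark v) < ε) ∧
  ∀ v e (h : v ∈ N.ends e),
    dist (N'.edgeMark (φ.toV v) (φ.toE e) ((φ.inc v e).1 h)) (N.edgeMark v e h) < ε

def GraphIso.refl (N : PreNetwork Ξ) : GraphIso N N := ⟨.refl _, .refl _, fun _ _ => Iff.rfl⟩

def GraphIso.symm {N N' : PreNetwork Ξ} (φ : GraphIso N N') : GraphIso N' N :=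
  ⟨φ.toV.symm, φ.toE.symm, fun v e => by
    rw [φ.inc, Equiv.apply_symm_apply, Equiv.apply_symm_apply]⟩

def GraphIso.trans {N N' N'' : PreNetwork Ξ} (φ : GraphIso N N') (ψ : GraphIso N' N'') :
    GraphIso N N'' :=
  ⟨φ.toV.trans ψ.toV, φ.toE.trans ψ.toE, fun v e => (φ.inc v e).trans (ψ.inc _ _)⟩

theorem GraphIso.PreservesMarks.refl (N : PreNetwork Ξ) : (GraphIso.refl N).PreservesMarks :=
  ⟨fun _ => rfl, fun _ _ _ => rfl⟩

theorem GraphIso.PreservesMarks.symm {N N' : PreNetwork Ξ} {φ : GraphIso N N'}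
    (h : φ.PreservesMarks) : φ.symm.PreservesMarks := by
  constructor
  · intro v
    have := h.1 (φ.toV.symm v)
    rw [Equiv.apply_symm_apply] at this
    exact this.symm
  · intro v e hv
    obtain ⟨v, rfl⟩ := φ.toV.surjective v
    obtain ⟨e, rfl⟩ := φ.toE.surjective e
    rw [h.2 v e ((φ.inc v e).2 hv)]
    simp [GraphIso.symm]

theorem GraphIso.PreservesMarks.trans {N N' N'' : PreNetwork Ξ} {φ : GraphIso N N'}
    {ψ : GraphIso N' N''} (h : φ.PreservesMarks) (h' : ψ.PreservesMarks) :
    (φ.trans ψ).PreservesMarks :=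
  ⟨fun v => (h'.1 _).trans (h.1 v), fun v e hv => (h'.2 _ _ _).trans (h.2 v e hv)⟩

end PreNetwork

/-- A network: a connected, locally finite, marked multigraph with marks in `Ξ`. Such a multigraph
is countable, so vertex and edge types in `Type` represent all isomorphism classes. -/
structure Network (Ξ : Type*) extends PreNetwork Ξ where
  connected : toPreNetwork.graph.Connected

/-- Isomorphism of networks. -/
def Network.setoid (Ξ : Type*) : Setoid (Network Ξ) where
  r N N' := ∃ φ : PreNetwork.GraphIso N.toPreNetwork N'.toPreNetwork, φ.PreservesMarks
  iseqv :=
    { refl := fun N => ⟨_, PreNetwork.GraphIso.PreservesMarks.refl N.toPreNetwork⟩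
      symm := fun ⟨_, h⟩ => ⟨_, h.symm⟩
      trans := fun ⟨_, h⟩ ⟨_, h'⟩ => ⟨_, h.trans h'⟩ }

/-- Isomorphism of networks with `k` distinguished vertices. -/
def Network.rootedSetoid (Ξ : Type*) (k : ℕ) : Setoid ((N : Network Ξ) × (Fin k → N.V)) where
  r p q := ∃ φ : PreNetwork.GraphIso p.1.toPreNetwork q.1.toPreNetwork,
    φ.PreservesMarks ∧ ∀ i, φ.toV (p.2 i) = q.2 i
  iseqv :=
    { refl := fun p => ⟨_, PreNetwork.GraphIso.PreservesMarks.refl p.1.toPreNetwork, fun _ => rfl⟩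
      symm := fun ⟨φ, h, hr⟩ => ⟨_, h.symm, fun i => (Equiv.symm_apply_eq φ.toV).2 (hr i).symm⟩
      trans := fun ⟨_, h, hr⟩ ⟨ψ, h', hr'⟩ =>
        ⟨_, h.trans h', fun i => (congrArg ψ.toV (hr i)).trans (hr' i)⟩ }

/-- The set of isomorphism classes of (non-rooted) networks. -/
def UnrootedNet (Ξ : Type*) := Quotient (Network.setoid Ξ)

/-- Isomorphism classes of networks with `k` roots. -/
def RootedNet (Ξ : Type*) (k : ℕ) := Quotient (Network.rootedSetoid Ξ k)

/-- The set of isomorphism classes of rooted networks. -/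
abbrev GStar (Ξ : Type*) := RootedNet Ξ 1

/-- The set of isomorphism classes of doubly-rooted networks. -/
abbrev GStarStar (Ξ : Type*) := RootedNet Ξ 2

namespace RootedNet

variable {Ξ : Type*} {k : ℕ}

/-- The class of a network with given roots. -/
def mk (N : Network Ξ) (R : Fin k → N.V) : RootedNet Ξ k :=
  Quotient.mk (Network.rootedSetoid Ξ k) ⟨N, R⟩

theorem mk_eq {N N' : Network Ξ} {R : Fin k → N.V} {R' : Fin k → N'.V}
    (φ : PreNetwork.GraphIso N.toPreNetwork N'.toPreNetwork) (h : φ.PreservesMarks)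
    (hR : ∀ i, φ.toV (R i) = R' i) : mk N R = mk N' R' :=
  Quotient.sound (s := Network.rootedSetoid Ξ k) ⟨φ, h, hR⟩

/-- The vertices at graph-distance at most `r` from one of the roots. -/
def ball (N : Network Ξ) (R : Fin k → N.V) (r : ℕ) : Set N.V :=
  {v | ∃ i, N.graph.dist (R i) v ≤ r}

theorem root_mem_ball (N : Network Ξ) (R : Fin k → N.V) (r : ℕ) (i : Fin k) :
    R i ∈ ball N R r := ⟨i, by simp⟩

/-- The subnetworks induced by the `r`-balls around the roots are isomorphic as multigraphs with
roots, and corresponding marks differ by less than `ε`. -/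
def Near [MetricSpace Ξ] (r : ℕ) (ε : ℝ) (N N' : Network Ξ) (R : Fin k → N.V)
    (R' : Fin k → N'.V) : Prop :=
  ∃ φ : PreNetwork.GraphIso (N.induce (ball N R r)) (N'.induce (ball N' R' r)),
    (∀ i, φ.toV ⟨R i, root_mem_ball N R r i⟩ = ⟨R' i, root_mem_ball N' R' r i⟩) ∧
    φ.MarksWithin ε

/-- The local topology: it is generated by the sets of all networks that look like a given one
in the `r`-balls around the roots, up to `ε` in the marks. -/
instance [MetricSpace Ξ] : TopologicalSpace (RootedNet Ξ k) :=
  generateFrom {U | ∃ (N : Network Ξ) (R : Fin k → N.V) (r : ℕ) (ε : ℝ), 0 < ε ∧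
    U = {y | ∃ (N' : Network Ξ) (R' : Fin k → N'.V), y = mk N' R' ∧ Near r ε N N' R R'}}

instance [MetricSpace Ξ] : MeasurableSpace (RootedNet Ξ k) := borel _

instance [MetricSpace Ξ] : BorelSpace (RootedNet Ξ k) := ⟨rfl⟩

/-- Keep the `i`-th root and forget the other ones. -/
def keepRoot (i : Fin k) : RootedNet Ξ k → GStar Ξ :=
  Quotient.lift (fun p => mk p.1 ![p.2 i]) (by
    rintro p q ⟨φ, h, hR⟩
    exact mk_eq φ h (by simp [hR]))

/-- The projection forgetting the roots. -/
def forget : RootedNet Ξ k → UnrootedNet Ξ :=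
  Quotient.map' (s₁ := Network.rootedSetoid Ξ k) (s₂ := Network.setoid Ξ) Sigma.fst
    (fun _ _ ⟨φ, h, _⟩ => ⟨φ, h⟩)

end RootedNet

/-- The sigma-field on non-rooted networks: the sets whose preimage under the projection
from rooted networks is measurable. -/
instance {Ξ : Type*} [MetricSpace Ξ] : MeasurableSpace (UnrootedNet Ξ) :=
  MeasurableSpace.map (RootedNet.forget (k := 1)) inferInstance

/-- A covariant subset of the vertices: a choice of `S_N ⊆ V(N)` for all networks `N` that is
compatible with isomorphisms and such that `{[N, o] | o ∈ S_N}` is measurable. -/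
structure CovariantSubset (Ξ : Type*) [MetricSpace Ξ] where
  carrier : (N : Network Ξ) → Set N.V
  covariant : ∀ {N N' : Network Ξ} (φ : PreNetwork.GraphIso N.toPreNetwork N'.toPreNetwork),
    φ.PreservesMarks → ∀ v, v ∈ carrier N ↔ φ.toV v ∈ carrier N'
  measurable : MeasurableSet {x : GStar Ξ | ∃ (N : Network Ξ) (o : N.V),
    x = RootedNet.mk N ![o] ∧ o ∈ carrier N}

section

variable {Ξ : Type*} [MetricSpace Ξ]

/-- The event that the root belongs to `S`. -/
def CovariantSubset.rootIn (S : CovariantSubset Ξ) : Set (GStar Ξ) :=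
  {x | ∃ (N : Network Ξ) (o : N.V), x = RootedNet.mk N ![o] ∧ o ∈ S.carrier N}

/-- The sum of `g[G, o, v]` over all vertices `v` of `G`, as a function of `[G, o]`. -/
def outSum (g : GStarStar Ξ → ℝ≥0) : GStar Ξ → ℝ≥0∞ :=
  Quotient.lift (fun p => ∑' v : p.1.V, (g (RootedNet.mk p.1 ![p.2 0, v]) : ℝ≥0∞)) (by
    rintro p q ⟨φ, h, hR⟩
    rw [← φ.toV.tsum_eq]
    refine tsum_congr fun v => ?_
    rw [RootedNet.mk_eq φ h (R' := ![q.2 0, φ.toV v])]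
    simp [Fin.forall_fin_two, hR])

/-- The sum of `g[G, v, o]` over all vertices `v` of `G`, as a function of `[G, o]`. -/
def inSum (g : GStarStar Ξ → ℝ≥0) : GStar Ξ → ℝ≥0∞ :=
  Quotient.lift (fun p => ∑' v : p.1.V, (g (RootedNet.mk p.1 ![v, p.2 0]) : ℝ≥0∞)) (by
    rintro p q ⟨φ, h, hR⟩
    rw [← φ.toV.tsum_eq]
    refine tsum_congr fun v => ?_
    rw [RootedNet.mk_eq φ h (R' := ![φ.toV v, q.2 0])]
    simp [Fin.forall_fin_two, hR])

/-- The sum of `g[G, o, v]` over `v ∈ S_G`. -/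
def outSumOn (S : CovariantSubset Ξ) (g : GStarStar Ξ → ℝ≥0) : GStar Ξ → ℝ≥0∞ :=
  Quotient.lift
    (fun p => ∑' v : S.carrier p.1, (g (RootedNet.mk p.1 ![p.2 0, v.1]) : ℝ≥0∞)) (by
    rintro p q ⟨φ, h, hR⟩
    rw [← (φ.toV.subtypeEquiv (S.covariant φ h)).tsum_eq]
    refine tsum_congr fun v => ?_
    rw [RootedNet.mk_eq φ h (R' := ![q.2 0, φ.toV v.1])]
    · rfl
    · simp [Fin.forall_fin_two, hR])

/-- The sum of `g[G, v, o]` over `v ∈ S_G`. -/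
def inSumOn (S : CovariantSubset Ξ) (g : GStarStar Ξ → ℝ≥0) : GStar Ξ → ℝ≥0∞ :=
  Quotient.lift
    (fun p => ∑' v : S.carrier p.1, (g (RootedNet.mk p.1 ![v.1, p.2 0]) : ℝ≥0∞)) (by
    rintro p q ⟨φ, h, hR⟩
    rw [← (φ.toV.subtypeEquiv (S.covariant φ h)).tsum_eq]
    refine tsum_congr fun v => ?_
    rw [RootedNet.mk_eq φ h (R' := ![φ.toV v.1, q.2 0])]
    · rfl
    · simp [Fin.forall_fin_two, hR])

/-- The mass transport principle. -/
def IsUnimodular (μ : Measure (GStar Ξ)) : Prop :=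
  ∀ g : GStarStar Ξ → ℝ≥0, Measurable g → ∫⁻ x, outSum g x ∂μ = ∫⁻ x, inSum g x ∂μ

/-- `(μ, S)` is an extension of the random rooted network `μ₀`: the root is in `S` and `S` is
connected almost surely, and the law of the induced subnetwork `[S_G, o]` under `μ` is `μ₀`.
The mark space `Ξ` of the extension may be larger than the mark space `Ξ₀` of `μ₀`, which is
regarded as a subspace of `Ξ` through `ι`. -/
structure IsExtension {Ξ₀ : Type*} [MetricSpace Ξ₀] (ι : Ξ₀ → Ξ) (μ₀ : Measure (GStar Ξ₀))
    (μ : Measure (GStar Ξ)) (S : CovariantSubset Ξ) : Prop where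
  root_mem : ∀ᵐ x ∂μ, x ∈ S.rootIn
  connected : ∀ᵐ x ∂μ, ∀ (N : Network Ξ) (o : N.V), x = RootedNet.mk N ![o] →
    (N.induce (S.carrier N)).graph.Connected
  law : ∀ B : Set (GStar Ξ), MeasurableSet B →
    μ {x | ∃ (N : Network Ξ) (o : N.V) (ho : o ∈ S.carrier N)
        (hc : (N.induce (S.carrier N)).graph.Connected),
        x = RootedNet.mk N ![o] ∧
        RootedNet.mk ⟨N.induce (S.carrier N), hc⟩ ![⟨o, ho⟩] ∈ B} =
      μ₀ {x | ∃ (N : Network Ξ₀) (o : N.V), x = RootedNet.mk N ![o] ∧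
        RootedNet.mk ⟨N.mapMarks ι, N.connected⟩ ![o] ∈ B}

/-- A proper extension satisfies in addition the mass transport principle on `S`. -/
structure IsProperExtension {Ξ₀ : Type*} [MetricSpace Ξ₀] (ι : Ξ₀ → Ξ)
    (μ₀ : Measure (GStar Ξ₀)) (μ : Measure (GStar Ξ)) (S : CovariantSubset Ξ) : Prop extends
    IsExtension ι μ₀ μ S where
  mtp : ∀ g : GStarStar Ξ → ℝ≥0, Measurable g →
    ∫⁻ x, outSumOn S g x ∂μ = ∫⁻ x, inSumOn S g x ∂μ

/-- `ν` is a (weak) unimodularization of the random non-rooted network with law `κ`. -/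
structure IsUnimodularization (ν : Measure (GStar Ξ)) (κ : Measure (UnrootedNet Ξ)) : Prop where
  isProbabilityMeasure : IsProbabilityMeasure ν
  isUnimodular : IsUnimodular ν
  absolutelyContinuous : ν.map RootedNet.forget ≪ κ
  absolutelyContinuous' : κ ≪ ν.map RootedNet.forget

/-- Almost surely, `T_G` is a Markovian transport kernel from `V(G)` to `S_G`: for all
`v ∈ V(G)`, the total mass sent by `v` is `1` and `v` sends no mass outside `S_G`. -/
def IsMarkovianInto (μ : Measure (GStar Ξ)) (S : CovariantSubset Ξ) (T : GStarStar Ξ → ℝ≥0) :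
    Prop :=
  ∀ᵐ x ∂μ, ∀ (N : Network Ξ) (o : N.V), x = RootedNet.mk N ![o] → ∀ v : N.V,
    ∑' w : N.V, (T (RootedNet.mk N ![v, w]) : ℝ≥0∞) = 1 ∧
    ∀ w ∉ S.carrier N, T (RootedNet.mk N ![v, w]) = 0

open Classical in
/-- `A ↦ (1 / E[M]) E[∑_v T_G(v, o) 1_A[G, v]]`, where `M = ∑_v T_G(v, o)`. -/
def transportLaw (μ : Measure (GStar Ξ)) (T : GStarStar Ξ → ℝ≥0) (A : Set (GStar Ξ)) : ℝ≥0∞ :=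
  (∫⁻ x, inSum T x ∂μ)⁻¹ *
    ∫⁻ x, inSum (fun y => if y.keepRoot 0 ∈ A then T y else 0) x ∂μ

end

end

/-! Write `T(v,w)` for `T[G,v,w]`, and let `ν` be a unimodularization whose conditional law on the
event that the root lies in `S` is `μ`. Being a Markovian kernel into `S` does not depend on the
root, so it passes from `μ` to `ν` by absolute continuity. Under `ν`, let each root in the event `A`
send mass `T(o,w)` to `w`. A root in `A` sends out `1`, and mass arrives only in `S`, so the mass
transport principle expresses `ν A` through the restriction of `ν` to `S`
(`IsUnimodular.measure_eq`). That restriction is a multiple of `μ`, and the total mass `1` forces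
the factor `1/E[M]`. Hence `E[M]` is finite and `ν` is the transport law
(`IsUnimodularization.eq_transportLaw`). Uniqueness needs some `T`; choosing uniformly among the
nearest vertices of `S` provides one.

Conversely, let `E[M]` be finite. To see that the transport law is unimodular, take `H(o,u) = ∑
T(v,o) g(v,w) T(w,u)`, summed over `v` and `w`, and apply the mass transport principle on `S` to
`H`. Since `∑ T(w,u)` over `u` in `S` is `1`, one of the two factors `T` disappears on each side,
which leaves the two sides of the required identity (`IsProperExtension.lintegral_transport`). The
principle on `S` applied to `T(v,o) f[G,v]` shows that the unnormalized law agrees with `μ` on `S`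
(`IsProperExtension.lintegral_transport_rootIn`), which gives the conditional law.

The remaining work is measurability: summing a measurable function over an additional root is
measurable (`measurable_sumRoot`). Quantifiers over vertices are then handled as vanishing of such
sums. -/

/-- An equivalence between subtypes restricts to smaller subtypes. -/
def subtypeEquivRestrict {α β : Type*} {p q : α → Prop} {p' q' : β → Prop}
    (f : {a // p a} ≃ {b // p' b}) (hq : ∀ a, q a → p a) (hq' : ∀ b, q' b → p' b)
    (h : ∀ a : {a // p a}, q a.1 ↔ q' (f a).1) : {a // q a} ≃ {b // q' b} where
  toFun a := ⟨(f ⟨a.1, hq _ a.2⟩).1, (h _).1 a.2⟩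
  invFun b := ⟨(f.symm ⟨b.1, hq' _ b.2⟩).1, (h _).2 (by rw [f.apply_symm_apply]; exact b.2)⟩
  left_inv a := by simp
  right_inv b := by simp

/-! ### Isomorphisms between induced subnetworks. -/

namespace PreNetwork

variable {Ξ : Type*} {N N' : PreNetwork Ξ}

theorem graph_adj {u v : N.V} : N.graph.Adj u v ↔ (∃ e, N.ends e = s(u, v)) ∧ u ≠ v := by
  simp [graph, SimpleGraph.fromEdgeSet_adj]

theorem mem_induce_ends {s : Set N.V} {e : (N.induce s).E} {v : (N.induce s).V} :
    v ∈ (N.induce s).ends e ↔ v.1 ∈ N.ends e.1 := by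
  have h := Sym2.mem_map (f := Subtype.val) (z := (N.ends e.1).attachWith e.2) (b := v.1)
  rw [Sym2.attachWith_map_subtypeVal] at h
  rw [h]
  refine ⟨fun hv => ⟨v, hv, rfl⟩, ?_⟩
  rintro ⟨w, hw, hwv⟩
  rwa [← Subtype.ext hwv]

/-- This form uses only incidence, which is what `GraphIso.inc` preserves. -/
theorem graph_adj_iff_mem {u v : N.V} :
    N.graph.Adj u v ↔ (∃ e, u ∈ N.ends e ∧ v ∈ N.ends e) ∧ u ≠ v := by
  rw [graph_adj]
  refine and_congr_left fun h => exists_congr fun e => ?_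
  exact (Sym2.mem_and_mem_iff h).symm

theorem induce_graph_adj {s : Set N.V} {u v : (N.induce s).V} :
    (N.induce s).graph.Adj u v ↔ N.graph.Adj u.1 v.1 := by
  rw [graph_adj_iff_mem, graph_adj_iff_mem]
  constructor
  · rintro ⟨⟨e, hu, hv⟩, huv⟩
    exact ⟨⟨e.1, mem_induce_ends.1 hu, mem_induce_ends.1 hv⟩, fun h => huv (Subtype.ext h)⟩
  · rintro ⟨⟨e, hu, hv⟩, huv⟩
    have he := (Sym2.mem_and_mem_iff huv).1 ⟨hu, hv⟩
    have hs : ∀ w ∈ N.ends e, w ∈ s := by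
      intro w hw
      rw [he, Sym2.mem_iff] at hw
      rcases hw with rfl | rfl
      exacts [u.2, v.2]
    exact ⟨⟨⟨e, hs⟩, mem_induce_ends.2 hu, mem_induce_ends.2 hv⟩, fun h => huv (by rw [h])⟩

theorem GraphIso.adj (φ : GraphIso N N') {u v : N.V} (h : N.graph.Adj u v) :
    N'.graph.Adj (φ.toV u) (φ.toV v) := by
  rw [graph_adj_iff_mem] at h ⊢
  obtain ⟨⟨e, hu, hv⟩, huv⟩ := h
  exact ⟨⟨φ.toE e, (φ.inc _ _).1 hu, (φ.inc _ _).1 hv⟩, φ.toV.injective.ne huv⟩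

theorem GraphIso.exists_walk {s : Set N.V} {s' : Set N'.V}
    (φ : GraphIso (N.induce s) (N'.induce s')) {u v : N.V} (p : N.graph.Walk u v)
    (hp : ∀ x ∈ p.support, x ∈ s) :
    ∃ q : N'.graph.Walk (φ.toV ⟨u, hp u p.start_mem_support⟩).1
      (φ.toV ⟨v, hp v p.end_mem_support⟩).1, q.length = p.length := by
  induction p with
  | nil => exact ⟨.nil, rfl⟩
  | cons h p ih =>
    obtain ⟨q, hq⟩ := ih fun x hx => hp x (by simp [hx])
    refine ⟨.cons (induce_graph_adj.1 (φ.adj (induce_graph_adj.2 ?_))) q, by simp [hq]⟩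
    exact h

/-- Lets the edge bijection restrict along with the vertex bijection in `GraphIso.restrict`. -/
theorem GraphIso.ends_subset_iff {s t : Set N.V} {s' t' : Set N'.V}
    (φ : GraphIso (N.induce s) (N'.induce s'))
    (h : ∀ v : (N.induce s).V, v.1 ∈ t ↔ (φ.toV v).1 ∈ t') (e : (N.induce s).E) :
    (∀ v ∈ N.ends e.1, v ∈ t) ↔ ∀ w ∈ N'.ends (φ.toE e).1, w ∈ t' := by
  constructor
  · intro he w hw
    obtain ⟨v, hv⟩ := φ.toV.surjective ⟨w, (φ.toE e).2 w hw⟩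
    obtain rfl : (φ.toV v).1 = w := by rw [hv]
    exact (h v).1 (he _ (mem_induce_ends.1 ((φ.inc v e).2 (mem_induce_ends.2 hw))))
  · intro he v hv
    refine (h ⟨v, e.2 v hv⟩).2 (he _ (mem_induce_ends.1 ((φ.inc _ e).1 ?_)))
    exact mem_induce_ends.2 hv

/-- Restriction of an isomorphism of induced subnetworks to smaller subnetworks. -/
def GraphIso.restrict {s t : Set N.V} {s' t' : Set N'.V}
    (φ : GraphIso (N.induce s) (N'.induce s')) (ht : t ⊆ s) (ht' : t' ⊆ s')
    (h : ∀ v : (N.induce s).V, v.1 ∈ t ↔ (φ.toV v).1 ∈ t') :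
    GraphIso (N.induce t) (N'.induce t') where
  toV := subtypeEquivRestrict (p := (· ∈ s)) (p' := (· ∈ s')) φ.toV ht ht' h
  toE := subtypeEquivRestrict (p := fun e => ∀ v ∈ N.ends e, v ∈ s)
    (p' := fun e => ∀ v ∈ N'.ends e, v ∈ s') φ.toE (fun _ he v hv => ht (he v hv))
    (fun _ he v hv => ht' (he v hv)) (φ.ends_subset_iff h)
  inc v e := by
    have h₀ := φ.inc ⟨v.1, ht v.2⟩ ⟨e.1, fun v hv => ht (e.2 v hv)⟩
    have h₁ := mem_induce_ends.symm.trans (h₀.trans mem_induce_ends)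
    refine mem_induce_ends.trans (h₁.trans (Iff.symm ?_))
    exact mem_induce_ends

theorem GraphIso.MarksWithin.restrict [MetricSpace Ξ] {s t : Set N.V} {s' t' : Set N'.V}
    {φ : GraphIso (N.induce s) (N'.induce s')} {ε : ℝ} (hφ : φ.MarksWithin ε) (ht : t ⊆ s)
    (ht' : t' ⊆ s') (h : ∀ v : (N.induce s).V, v.1 ∈ t ↔ (φ.toV v).1 ∈ t') :
    (φ.restrict ht ht' h).MarksWithin ε :=
  ⟨fun v => hφ.1 ⟨v.1, ht v.2⟩, fun v e hv =>
    hφ.2 ⟨v.1, ht v.2⟩ ⟨e.1, fun v hv => ht (e.2 v hv)⟩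
      (mem_induce_ends.2 (mem_induce_ends.1 hv :))⟩

theorem GraphIso.MarksWithin.mono [MetricSpace Ξ] {φ : GraphIso N N'} {ε δ : ℝ}
    (h : φ.MarksWithin ε) (hεδ : ε ≤ δ) : φ.MarksWithin δ :=
  ⟨fun v => (h.1 v).trans_le hεδ, fun v e hv => (h.2 v e hv).trans_le hεδ⟩

theorem GraphIso.MarksWithin.trans [MetricSpace Ξ] {N'' : PreNetwork Ξ} {φ : GraphIso N N'}
    {ψ : GraphIso N' N''} {ε δ : ℝ} (h : φ.MarksWithin ε) (h' : ψ.MarksWithin δ) :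
    (φ.trans ψ).MarksWithin (ε + δ) := by
  refine ⟨fun v => ?_, fun v e hv => ?_⟩
  · have h₁ := h.1 v
    have h₂ := h'.1 (φ.toV v)
    have h₃ := dist_triangle (N''.vertexMark (ψ.toV (φ.toV v))) (N'.vertexMark (φ.toV v))
      (N.vertexMark v)
    exact h₃.trans_lt (by linarith)
  · have h₁ := h.2 v e hv
    have h₂ := h'.2 (φ.toV v) (φ.toE e) ((φ.inc v e).1 hv)
    exact (dist_triangle _ _ _).trans_lt ((add_lt_add h₂ h₁).trans_le (add_comm δ ε).le)

/-- Only finitely many edges are incident to a vertex. -/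
instance finite_incident (N : PreNetwork Ξ) (v : N.V) : Finite {e // v ∈ N.ends e} :=
  N.locallyFinite v

/-- Finitely many strict inequalities between marks leave some room. -/
theorem GraphIso.MarksWithin.exists_lt [MetricSpace Ξ] [Finite N.V] {φ : GraphIso N N'}
    {ε : ℝ} (hε : 0 < ε) (h : φ.MarksWithin ε) : ∃ δ, 0 < δ ∧ δ < ε ∧ φ.MarksWithin δ := by
  have h₁ : ∀ᶠ δ in nhdsWithin ε (Set.Iio ε),
      ∀ v, dist (N'.vertexMark (φ.toV v)) (N.vertexMark v) < δ :=
    Filter.eventually_all.2 fun v =>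
      nhdsWithin_le_nhds (lt_mem_nhds (h.1 v))
  have h₂ : ∀ᶠ δ in nhdsWithin ε (Set.Iio ε), ∀ v, ∀ e : {e // v ∈ N.ends e},
      dist (N'.edgeMark (φ.toV v) (φ.toE e.1) ((φ.inc v e.1).1 e.2))
        (N.edgeMark v e.1 e.2) < δ :=
    Filter.eventually_all.2 fun v => Filter.eventually_all.2 fun e =>
      nhdsWithin_le_nhds (lt_mem_nhds (h.2 v e.1 e.2))
  have h₃ : ∀ᶠ δ in nhdsWithin ε (Set.Iio ε), 0 < δ := nhdsWithin_le_nhds (lt_mem_nhds hε)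
  obtain ⟨δ, ⟨⟨h₁, h₂⟩, h₃⟩, h₄⟩ := ((h₁.and h₂).and h₃ |>.and self_mem_nhdsWithin).exists
  exact ⟨δ, h₃, h₄, h₁, fun v e hv => h₂ v ⟨e, hv⟩⟩

end PreNetwork

/-! ### Global isomorphisms and finiteness of balls. -/

namespace PreNetwork

variable {Ξ : Type*} {N N' : PreNetwork Ξ}

/-- An isomorphism restricts to induced subnetworks. -/
def GraphIso.induce (φ : GraphIso N N') {s : Set N.V} {s' : Set N'.V}
    (h : ∀ v, v ∈ s ↔ φ.toV v ∈ s') : GraphIso (N.induce s) (N'.induce s') where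
  toV := φ.toV.subtypeEquiv h
  toE := φ.toE.subtypeEquiv fun e => by
    constructor
    · intro he w hw
      obtain ⟨v, rfl⟩ := φ.toV.surjective w
      exact (h v).1 (he v ((φ.inc v e).2 hw))
    · intro he v hv
      exact (h v).2 (he _ ((φ.inc v e).1 hv))
  inc v e := by
    refine mem_induce_ends.trans ((φ.inc v.1 e.1).trans (Iff.symm ?_))
    exact mem_induce_ends

theorem GraphIso.PreservesMarks.marksWithin_induce [MetricSpace Ξ] {φ : GraphIso N N'}
    (hφ : φ.PreservesMarks) {s : Set N.V} {s' : Set N'.V} (h : ∀ v, v ∈ s ↔ φ.toV v ∈ s')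
    {ε : ℝ} (hε : 0 < ε) : (φ.induce h).MarksWithin ε := by
  refine ⟨fun v => ?_, fun v e hv => ?_⟩
  · have := hφ.1 v.1
    exact (dist_eq_zero.2 this).trans_lt hε
  · have := hφ.2 v.1 e.1 (mem_induce_ends.1 hv)
    exact (dist_eq_zero.2 this).trans_lt hε

theorem GraphIso.dist_le (φ : GraphIso N N') (hN : N.graph.Connected) (u v : N.V) :
    N'.graph.dist (φ.toV u) (φ.toV v) ≤ N.graph.dist u v := by
  obtain ⟨p, hp⟩ := (hN u v).exists_walk_length_eq_dist
  let f : N.graph →g N'.graph := ⟨φ.toV, fun h => φ.adj h⟩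
  rw [← hp, ← p.length_map f]
  exact SimpleGraph.dist_le (p.map f)

theorem finite_neighbors (u : N.V) : {v | N.graph.Adj u v}.Finite := by
  have h : {v | N.graph.Adj u v} ⊆ ⋃ e ∈ {e | u ∈ N.ends e}, {v | v ∈ N.ends e} := by
    intro v hv
    obtain ⟨⟨e, hu, hv⟩, -⟩ := graph_adj_iff_mem.1 hv
    exact Set.mem_biUnion (x := e) hu hv
  refine Set.Finite.subset (Set.Finite.biUnion (N.locallyFinite u) fun e _ => ?_) h
  induction N.ends e with
  | _ x y =>
    refine (Set.toFinite {x, y}).subset fun v hv => ?_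
    simpa using hv

end PreNetwork

namespace Network

variable {Ξ : Type*}

theorem finite_dist_le (N : Network Ξ) (u : N.V) (r : ℕ) :
    {v | N.graph.dist u v ≤ r}.Finite := by
  induction r generalizing u with
  | zero =>
    refine (Set.finite_singleton u).subset fun v hv => ?_
    have h : N.graph.dist u v = 0 := by simpa using hv
    exact ((N.connected u v).dist_eq_zero_iff.1 h).symm
  | succ r ih =>
    refine ((Set.finite_singleton u).union ((PreNetwork.finite_neighbors u).biUnion
      fun w _ => ih w)).subset fun v hv => ?_
    obtain ⟨p, hp⟩ := (N.connected u v).exists_walk_length_eq_dist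
    cases p with
    | nil => exact Or.inl rfl
    | cons h p =>
      refine Or.inr (Set.mem_biUnion h ?_)
      have h₁ : N.graph.dist u v ≤ r + 1 := hv
      have h₂ := SimpleGraph.dist_le p
      simp only [SimpleGraph.Walk.length_cons] at hp
      exact h₂.trans (by omega)

end Network

/-! ### The local topology and its neighbourhoods. -/

namespace RootedNet

open PreNetwork

variable {Ξ : Type*} {k : ℕ} {N N' N'' : Network Ξ} {R : Fin k → N.V} {R' : Fin k → N'.V}
  {R'' : Fin k → N''.V} {r s : ℕ} {ε δ : ℝ}

theorem finite_ball (N : Network Ξ) (R : Fin k → N.V) (r : ℕ) : (ball N R r).Finite := by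
  have : ball N R r = ⋃ i, {v | N.graph.dist (R i) v ≤ r} := by
    ext v; simp [ball]
  rw [this]
  exact Set.finite_iUnion fun i => N.finite_dist_le (R i) r

/-- The hypothesis keeps a geodesic from `u` to `v` inside the `s`-ball, where `φ` can transport it.
Used for `φ` and `φ.symm` together, it gives preservation of distances. -/
theorem dist_map_le {s' : Set N'.V} (φ : GraphIso (N.induce (ball N R s)) (N'.induce s'))
    (u v : (N.induce (ball N R s)).V)
    (h : ∃ i, N.graph.dist (R i) u.1 + N.graph.dist u.1 v.1 ≤ s) :
    N'.graph.dist (φ.toV u).1 (φ.toV v).1 ≤ N.graph.dist u.1 v.1 := by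
  classical
  obtain ⟨i, hi⟩ := h
  obtain ⟨p, hp⟩ := (N.connected u.1 v.1).exists_walk_length_eq_dist
  have hsupp : ∀ x ∈ p.support, x ∈ ball N R s := fun x hx => by
    have h₁ := SimpleGraph.dist_le (p.takeUntil x hx)
    have h₂ := p.length_takeUntil_le_length hx
    have h₃ := N.connected.dist_triangle (u := R i) (v := u.1) (w := x)
    exact ⟨i, by omega⟩
  obtain ⟨q, hq⟩ := φ.exists_walk p hsupp
  rw [← hp, ← hq]
  exact SimpleGraph.dist_le q

theorem dist_root_map_le {s' : Set N'.V}
    (φ : GraphIso (N.induce (ball N R s)) (N'.induce s')) (i : Fin k)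
    (v : (N.induce (ball N R s)).V) (h : N.graph.dist (R i) v.1 ≤ s) :
    N'.graph.dist (φ.toV ⟨R i, root_mem_ball N R s i⟩).1 (φ.toV v).1 ≤
      N.graph.dist (R i) v.1 :=
  dist_map_le φ ⟨R i, root_mem_ball N R s i⟩ v ⟨i, by simpa using h⟩

theorem map_mem_ball {s' : Set N'.V} (φ : GraphIso (N.induce (ball N R s)) (N'.induce s'))
    {m : ℕ} (Q : Fin m → (N.induce (ball N R s)).V)
    (hQ : ∀ j, ∃ i, N.graph.dist (R i) (Q j).1 + r ≤ s) (v : (N.induce (ball N R s)).V)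
    (hv : v.1 ∈ ball N (fun j => (Q j).1) r) :
    (φ.toV v).1 ∈ ball N' (fun j => (φ.toV (Q j)).1) r := by
  obtain ⟨j, hj⟩ := hv
  obtain ⟨i, hi⟩ := hQ j
  exact ⟨j, (dist_map_le φ (Q j) v ⟨i, by simp only at hj; omega⟩).trans hj⟩

theorem ball_subset_ball {m : ℕ} {Q : Fin m → N.V}
    (hQ : ∀ j, ∃ i, N.graph.dist (R i) (Q j) + r ≤ s) : ball N Q r ⊆ ball N R s := by
  rintro v ⟨j, hj⟩
  obtain ⟨i, hi⟩ := hQ j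
  exact ⟨i, (N.connected.dist_triangle (v := Q j)).trans (by omega)⟩

/-- Choose new roots among the old ones. -/
def reindex {m : ℕ} (σ : Fin m → Fin k) : RootedNet Ξ k → RootedNet Ξ m :=
  Quotient.lift (fun p => mk p.1 (p.2 ∘ σ)) (by
    rintro p q ⟨φ, h, hR⟩
    exact mk_eq φ h fun i => hR (σ i))

@[simp]
theorem reindex_mk {m : ℕ} (σ : Fin m → Fin k) (N : Network Ξ) (R : Fin k → N.V) :
    reindex σ (mk N R) = mk N (R ∘ σ) := rfl

/-- The graph-distance between two roots. -/
noncomputable def rootDist (i j : Fin k) : RootedNet Ξ k → ℕ :=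
  Quotient.lift (fun p => p.1.graph.dist (p.2 i) (p.2 j)) (by
    rintro p q ⟨φ, h, hR⟩
    have h₁ := φ.dist_le p.1.connected (p.2 i) (p.2 j)
    have h₂ := φ.symm.dist_le q.1.connected (q.2 i) (q.2 j)
    simp only [GraphIso.symm, Equiv.symm_apply_apply, ← hR] at h₁ h₂ ⊢
    omega)

@[simp]
theorem rootDist_mk (i j : Fin k) (N : Network Ξ) (R : Fin k → N.V) :
    rootDist i j (mk N R) = N.graph.dist (R i) (R j) := rfl

variable [MetricSpace Ξ]

/-- An almost isomorphism of `s`-balls makes all tuples of points deep inside near. -/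
theorem near_of_iso (φ : GraphIso (N.induce (ball N R s)) (N'.induce (ball N' R' s)))
    (hroot : ∀ i, φ.toV ⟨R i, root_mem_ball N R s i⟩ = ⟨R' i, root_mem_ball N' R' s i⟩)
    (hφ : φ.MarksWithin ε) {m : ℕ} (Q : Fin m → (N.induce (ball N R s)).V)
    (hQ : ∀ j, ∃ i, N.graph.dist (R i) (Q j).1 + r ≤ s) :
    Near r ε N N' (fun j => (Q j).1) (fun j => (φ.toV (Q j)).1) := by
  -- Distances to the roots do not grow, so the image tuple is equally deep and `φ.symm` satisfies
  -- the same hypotheses.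
  have hQ' : ∀ j, ∃ i, N'.graph.dist (R' i) (φ.toV (Q j)).1 + r ≤ s := fun j => by
    obtain ⟨i, hi⟩ := hQ j
    have h := dist_root_map_le φ i (Q j) (by omega)
    rw [hroot] at h
    exact ⟨i, by simp only at h; omega⟩
  have h : ∀ v : (N.induce (ball N R s)).V, v.1 ∈ ball N (fun j => (Q j).1) r ↔
      (φ.toV v).1 ∈ ball N' (fun j => (φ.toV (Q j)).1) r := fun v => by
    refine ⟨map_mem_ball φ Q hQ v, fun hv => ?_⟩
    have := map_mem_ball φ.symm (fun j => φ.toV (Q j)) hQ' (φ.toV v) hv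
    simpa [GraphIso.symm] using this
  exact ⟨φ.restrict (ball_subset_ball hQ) (ball_subset_ball hQ') h, fun i => rfl,
    hφ.restrict _ _ h⟩

theorem Near.mono_right (h : Near r ε N N' R R') (hεδ : ε ≤ δ) : Near r δ N N' R R' :=
  let ⟨φ, hR, hφ⟩ := h
  ⟨φ, hR, hφ.mono hεδ⟩

theorem Near.trans (h : Near r ε N N' R R') (h' : Near r δ N' N'' R' R'') :
    Near r (ε + δ) N N'' R R'' := by
  obtain ⟨φ, hR, hφ⟩ := h
  obtain ⟨ψ, hR', hψ⟩ := h'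
  refine ⟨φ.trans ψ, fun i => ?_, hφ.trans hψ⟩
  exact (congrArg ψ.toV (hR i)).trans (hR' i)

theorem Near.reindex (h : Near s ε N N' R R') {m : ℕ} (σ : Fin m → Fin k) (hrs : r ≤ s) :
    Near r ε N N' (R ∘ σ) (R' ∘ σ) := by
  obtain ⟨φ, hR, hφ⟩ := h
  have h := near_of_iso φ hR hφ (r := r) (fun j => ⟨R (σ j), root_mem_ball N R s (σ j)⟩)
    fun j => ⟨σ j, by simpa using hrs⟩
  simp only [hR] at h
  exact h

theorem Near.mono_left (h : Near s ε N N' R R') (hrs : r ≤ s) : Near r ε N N' R R' :=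
  h.reindex id hrs

/-- Balls are finite, so the strict bounds on the marks leave a uniform gap. The gap supplies the
slack for triangle inequalities. -/
theorem Near.exists_lt (hε : 0 < ε) (h : Near r ε N N' R R') :
    ∃ δ, 0 < δ ∧ δ < ε ∧ Near r δ N N' R R' := by
  obtain ⟨φ, hR, hφ⟩ := h
  have : Finite (N.induce (ball N R r)).V := finite_ball N R r
  obtain ⟨δ, h₀, h₁, h₂⟩ := hφ.exists_lt hε
  exact ⟨δ, h₀, h₁, φ, hR, h₂⟩

theorem near_of_preservesMarks (φ : GraphIso N.toPreNetwork N'.toPreNetwork)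
    (hφ : φ.PreservesMarks) (hR : ∀ i, φ.toV (R i) = R' i) (r : ℕ) (hε : 0 < ε) :
    Near r ε N N' R R' := by
  have h : ∀ v, v ∈ ball N R r ↔ φ.toV v ∈ ball N' R' r := fun v => by
    refine exists_congr fun i => ?_
    have h₁ := φ.dist_le N.connected (R i) v
    have h₂ := φ.symm.dist_le N'.connected (R' i) (φ.toV v)
    simp only [GraphIso.symm, Equiv.symm_apply_apply, ← hR] at h₁ h₂ ⊢
    omega
  exact ⟨φ.induce h, fun i => Subtype.ext (hR i), hφ.marksWithin_induce h hε⟩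

theorem near_of_mk_eq (h : mk N R = mk N' R') (r : ℕ) (hε : 0 < ε) : Near r ε N N' R R' := by
  obtain ⟨φ, hφ, hR⟩ := Quotient.exact (s := Network.rootedSetoid Ξ k) h
  exact near_of_preservesMarks φ hφ hR r hε

theorem Near.trans_mk_eq (hε : 0 < ε) (h : Near r ε N N' R R') (h' : mk N' R' = mk N'' R'') :
    Near r ε N N'' R R'' := by
  obtain ⟨δ, -, h₁, h₂⟩ := h.exists_lt hε
  have := h₂.trans (near_of_mk_eq h' r (sub_pos.2 h₁))
  rwa [add_sub_cancel] at this

/-- The generating sets behave like open balls of a metric: by `Near.exists_lt` and `Near.trans`,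
such a set contains a smaller one centred at any of its points. -/
theorem isOpen_iff {U : Set (RootedNet Ξ k)} :
    IsOpen U ↔ ∀ (N : Network Ξ) (R : Fin k → N.V), mk N R ∈ U → ∃ (r : ℕ) (ε : ℝ), 0 < ε ∧
      ∀ (N' : Network Ξ) (R' : Fin k → N'.V), Near r ε N N' R R' → mk N' R' ∈ U := by
  constructor
  · intro hU
    induction hU with
    | basic U hU =>
      obtain ⟨N₀, R₀, r, ε, hε, rfl⟩ := hU
      rintro N R ⟨N₁, R₁, h, hN₁⟩
      obtain ⟨δ, -, h₁, h₂⟩ := (hN₁.trans_mk_eq hε h.symm).exists_lt hε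
      refine ⟨r, ε - δ, sub_pos.2 h₁, fun N' R' h' => ⟨N', R', rfl, ?_⟩⟩
      have := h₂.trans h'
      rwa [add_sub_cancel] at this
    | univ => exact fun _ _ _ => ⟨0, 1, one_pos, fun _ _ _ => trivial⟩
    | inter U V _ _ ihU ihV =>
      rintro N R ⟨hNU, hNV⟩
      obtain ⟨r, ε, hε, h⟩ := ihU N R hNU
      obtain ⟨r', ε', hε', h'⟩ := ihV N R hNV
      refine ⟨max r r', min ε ε', lt_min hε hε', fun N' R' hN' => ⟨h N' R' ?_, h' N' R' ?_⟩⟩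
      · exact (hN'.mono_left (le_max_left _ _)).mono_right (min_le_left _ _)
      · exact (hN'.mono_left (le_max_right _ _)).mono_right (min_le_right _ _)
    | sUnion 𝒰 _ ih =>
      rintro N R ⟨U, hU, hN⟩
      obtain ⟨r, ε, hε, h⟩ := ih U hU N R hN
      exact ⟨r, ε, hε, fun N' R' hN' => ⟨U, hU, h N' R' hN'⟩⟩
  · intro hU
    let 𝒰 : Set (Set (RootedNet Ξ k)) := {V | V ⊆ U ∧ IsOpen V}
    have : U = ⋃₀ 𝒰 := by
      refine Set.Subset.antisymm (fun x hx => ?_) (Set.sUnion_subset fun V hV => hV.1)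
      induction x using Quotient.inductionOn with
      | _ p =>
      obtain ⟨r, ε, hε, h⟩ := hU p.1 p.2 hx
      refine ⟨{y | ∃ (N' : Network Ξ) (R' : Fin k → N'.V), y = mk N' R' ∧
        Near r ε p.1 N' p.2 R'}, ⟨?_, ?_⟩, p.1, p.2, rfl, near_of_mk_eq rfl r hε⟩
      · rintro _ ⟨N', R', rfl, h'⟩
        exact h N' R' h'
      · exact isOpen_generateFrom_of_mem ⟨p.1, p.2, r, ε, hε, rfl⟩
    rw [this]
    exact isOpen_sUnion fun V hV => hV.2

theorem continuous_reindex {m : ℕ} (σ : Fin m → Fin k) :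
    Continuous (reindex σ : RootedNet Ξ k → RootedNet Ξ m) := by
  refine continuous_def.2 fun U hU => isOpen_iff.2 fun N R hN => ?_
  obtain ⟨r, ε, hε, h⟩ := isOpen_iff.1 hU N (R ∘ σ) hN
  exact ⟨r, ε, hε, fun N' R' h' => h N' (R' ∘ σ) (h'.reindex σ le_rfl)⟩

theorem measurable_reindex {m : ℕ} (σ : Fin m → Fin k) :
    Measurable (reindex σ : RootedNet Ξ k → RootedNet Ξ m) :=
  (continuous_reindex σ).borel_measurable

theorem isOpen_rootDist_eq (i j : Fin k) (n : ℕ) :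
    IsOpen {x : RootedNet Ξ k | rootDist i j x = n} := by
  -- Radius `n` suffices, because a geodesic between the two roots lies in the `n`-ball; the
  -- tolerance `1` on the marks plays no role.
  refine isOpen_iff.2 fun N R hN => ⟨n, 1, one_pos, fun N' R' h => ?_⟩
  obtain ⟨φ, hR, -⟩ := h
  simp only [Set.mem_ofPred_eq, rootDist_mk] at hN ⊢
  have h₁ := dist_root_map_le φ i ⟨R j, root_mem_ball N R n j⟩ hN.le
  rw [hR, hR] at h₁
  have h₂ := dist_root_map_le φ.symm i ⟨R' j, root_mem_ball N' R' n j⟩ (h₁.trans hN.le)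
  have hs : ∀ l, φ.symm.toV ⟨R' l, root_mem_ball N' R' n l⟩ = ⟨R l, root_mem_ball N R n l⟩ :=
    fun l => φ.toV.symm_apply_eq.2 (hR l).symm
  rw [hs, hs] at h₂
  exact (le_antisymm h₁ h₂).trans hN

theorem measurable_rootDist (i j : Fin k) : Measurable (rootDist i j : RootedNet Ξ k → ℕ) :=
  measurable_to_countable' fun n => (isOpen_rootDist_eq i j n).measurableSet

end RootedNet

/-! ### Measurability of sums over an additional root. -/

namespace RootedNet

open PreNetwork

variable {Ξ : Type*} {k : ℕ}

/-- The sum of a function over all choices of an additional root. -/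
noncomputable def sumRoot (F : RootedNet Ξ (k + 1) → ℝ≥0∞) : RootedNet Ξ k → ℝ≥0∞ :=
  Quotient.lift (fun p => ∑' v : p.1.V, F (mk p.1 (Matrix.vecCons v p.2))) (by
    rintro p q ⟨φ, h, hR⟩
    rw [← φ.toV.tsum_eq]
    refine tsum_congr fun v => ?_
    rw [mk_eq φ h (R' := Matrix.vecCons (φ.toV v) q.2)]
    exact Fin.cases rfl hR)

@[simp]
theorem sumRoot_mk (F : RootedNet Ξ (k + 1) → ℝ≥0∞) (N : Network Ξ) (R : Fin k → N.V) :
    sumRoot F (mk N R) = ∑' v : N.V, F (mk N (Matrix.vecCons v R)) := rfl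

theorem mk_out (x : RootedNet Ξ k) : mk x.out.1 x.out.2 = x :=
  Quotient.out_eq (s := Network.rootedSetoid Ξ k) x

theorem mk_surjective (x : RootedNet Ξ k) : ∃ (N : Network Ξ) (R : Fin k → N.V), mk N R = x :=
  ⟨_, _, mk_out x⟩

variable [MetricSpace Ξ]

theorem near_vecCons {N N' : Network Ξ} {R : Fin k → N.V} {R' : Fin k → N'.V} {r s : ℕ} {ε : ℝ}
    (φ : GraphIso (N.induce (ball N R s)) (N'.induce (ball N' R' s)))
    (hroot : ∀ i, φ.toV ⟨R i, root_mem_ball N R s i⟩ = ⟨R' i, root_mem_ball N' R' s i⟩)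
    (hφ : φ.MarksWithin ε) (v : (N.induce (ball N R s)).V)
    (hv : ∃ i, N.graph.dist (R i) v.1 + r ≤ s) :
    Near r ε N N' (Matrix.vecCons v.1 R) (Matrix.vecCons (φ.toV v).1 R') := by
  have hrs : r ≤ s := by obtain ⟨i, hi⟩ := hv; omega
  have := near_of_iso (r := r) φ hroot hφ
    (Matrix.vecCons v fun i => ⟨R i, root_mem_ball N R s i⟩)
    (Fin.cases hv fun i => ⟨i, by
      have : N.graph.dist (R i) (R i) + r ≤ s := by simpa using hrs
      exact this⟩)
  convert this using 1
  · ext j; cases j using Fin.cases <;> rfl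
  · ext j; cases j using Fin.cases with
    | zero => rfl
    | succ i => exact (congrArg Subtype.val (hroot i)).symm

/-- The sum counts the vertices that land in `U` when added as a root. Finitely many of them are
witnessed in one large ball, and an almost isomorphism of that ball maps them injectively to such
vertices of any nearby network. -/
theorem lowerSemicontinuous_sumRoot_indicator {U : Set (RootedNet Ξ (k + 2))} (hU : IsOpen U) :
    LowerSemicontinuous (sumRoot (U.indicator 1)) := by
  classical
  refine lowerSemicontinuous_iff_isOpen_preimage.2 fun y => isOpen_iff.2 fun N R hN => ?_
  rw [Set.mem_preimage, Set.mem_Ioi, sumRoot_mk, ENNReal.tsum_eq_iSup_sum, lt_iSup_iff] at hN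
  obtain ⟨t₀, ht₀⟩ := hN
  let t := t₀.filter fun v => mk N (Matrix.vecCons v R) ∈ U
  have ht : y < (t.card : ℝ≥0∞) := by
    simpa [t, Set.indicator_apply, ← Finset.sum_filter] using ht₀
  have hmem : ∀ v ∈ t, mk N (Matrix.vecCons v R) ∈ U := fun v hv => (Finset.mem_filter.1 hv).2
  have hex : ∀ v : N.V, ∃ (r : ℕ) (ε : ℝ), 0 < ε ∧ (v ∈ t → ∀ (N' : Network Ξ)
      (R' : Fin (k + 2) → N'.V), Near r ε N N' (Matrix.vecCons v R) R' → mk N' R' ∈ U) := by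
    intro v
    by_cases hv : v ∈ t
    · obtain ⟨r, ε, hε, h⟩ := isOpen_iff.1 hU N _ (hmem v hv)
      exact ⟨r, ε, hε, fun _ => h⟩
    · exact ⟨0, 1, one_pos, fun h => absurd h hv⟩
  choose r ε hε h using hex
  -- Large enough to contain the `r v`-ball around each `v` in `t`.
  let s := t.sup fun v => N.graph.dist (R 0) v + r v
  have hs : ∀ v ∈ t, N.graph.dist (R 0) v + r v ≤ s := fun v hv =>
    Finset.le_sup (f := fun v => N.graph.dist (R 0) v + r v) hv
  obtain ⟨δ, hδ, hδ₀⟩ : ∃ δ, (∀ v ∈ t, δ < ε v) ∧ 0 < δ := by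
    have h₁ : ∀ᶠ δ in nhdsWithin (0 : ℝ) (Set.Ioi 0), ∀ v ∈ t, δ < ε v :=
      (Filter.eventually_all_finset t).2 fun v _ => nhdsWithin_le_nhds (gt_mem_nhds (hε v))
    exact (h₁.and self_mem_nhdsWithin).exists
  refine ⟨s, δ, hδ₀, fun N' R' hnear => ?_⟩
  obtain ⟨φ, hR, hφ⟩ := hnear
  rw [Set.mem_preimage, Set.mem_Ioi, sumRoot_mk]
  refine ht.trans_le ?_
  have hball : ∀ v ∈ t, v ∈ ball N R s := fun v hv => ⟨0, le_of_add_le_left (hs v hv)⟩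
  let f : t → N'.V := fun v => (φ.toV ⟨v.1, hball v.1 v.2⟩).1
  have hf : Function.Injective f := fun v w hvw => by
    have := φ.toV.injective (Subtype.ext hvw)
    exact Subtype.ext (congrArg Subtype.val this :)
  refine le_trans (le_of_eq ?_) (ENNReal.tsum_comp_le_tsum_of_injective hf _)
  have hfU : ∀ v : t, mk N' (Matrix.vecCons (f v) R') ∈ U := fun v =>
    h v.1 v.2 N' _ ((near_vecCons φ hR hφ ⟨v.1, hball v.1 v.2⟩ ⟨0, hs v.1 v.2⟩).mono_right
      (hδ v.1 v.2).le)
  simp [hfU]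

/-- The sum of the Dirac masses at all choices of an additional root. -/
noncomputable def addRoot (x : RootedNet Ξ k) : Measure (RootedNet Ξ (k + 1)) :=
  Measure.sum fun v : x.out.1.V => Measure.dirac (mk x.out.1 (Matrix.vecCons v x.out.2))

theorem lintegral_addRoot {F : RootedNet Ξ (k + 1) → ℝ≥0∞} (hF : Measurable F)
    (x : RootedNet Ξ k) : ∫⁻ y, F y ∂addRoot x = sumRoot F x := by
  conv_rhs => rw [← mk_out x]
  simp [addRoot, lintegral_sum_measure, lintegral_dirac' _ hF]

theorem addRoot_apply {A : Set (RootedNet Ξ (k + 1))} (hA : MeasurableSet A)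
    (x : RootedNet Ξ k) : addRoot x A = sumRoot (A.indicator 1) x := by
  rw [← lintegral_addRoot (measurable_one.indicator hA), lintegral_indicator_one hA]

theorem isFiniteMeasure_restrict_addRoot (n : ℕ) (x : RootedNet Ξ (k + 1)) :
    IsFiniteMeasure ((addRoot x).restrict {y | rootDist 1 0 y = n}) := by
  classical
  have hD := (isOpen_rootDist_eq (Ξ := Ξ) (k := k + 2) 1 0 n).measurableSet
  refine ⟨?_⟩
  rw [Measure.restrict_apply_univ, addRoot_apply hD]
  obtain ⟨N, R, rfl⟩ := mk_surjective x
  rw [sumRoot_mk]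
  have hfin := (N.finite_dist_le (R 0) n)
  rw [tsum_eq_sum (s := hfin.toFinset)]
  · exact ENNReal.sum_lt_top.2 fun v _ =>
      (Set.indicator_le_self' (fun _ _ => zero_le) _).trans_lt ENNReal.one_lt_top
  · intro v hv
    refine Set.indicator_of_notMem (fun h => hv ?_) _
    rw [Set.Finite.mem_toFinset]
    exact le_of_eq h

/-- Open sets form a generating π-system on which `lowerSemicontinuous_sumRoot_indicator` applies.
The extension to all measurable sets needs finite measures, hence the restriction to new roots at
distance `n` from the first old root. -/
theorem measurable_restrict_addRoot (n : ℕ) :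
    Measurable fun x : RootedNet Ξ (k + 1) =>
      (addRoot x).restrict {y | rootDist 1 0 y = n} := by
  have hD := isOpen_rootDist_eq (Ξ := Ξ) (k := k + 2) 1 0 n
  have := isFiniteMeasure_restrict_addRoot (Ξ := Ξ) (k := k) n
  have key : ∀ U : Set (RootedNet Ξ (k + 2)), IsOpen U → Measurable fun x =>
      (addRoot x).restrict {y | rootDist 1 0 y = n} U := by
    intro U hU
    have : ∀ x : RootedNet Ξ (k + 1), (addRoot x).restrict {y | rootDist 1 0 y = n} U =
        sumRoot ((U ∩ {y | rootDist 1 0 y = n}).indicator 1) x := fun x => by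
      rw [Measure.restrict_apply hU.measurableSet, addRoot_apply (hU.inter hD).measurableSet]
    simp only [this]
    exact (lowerSemicontinuous_sumRoot_indicator (hU.inter hD)).measurable
  exact Measurable.measure_of_isPiSystem (S := {U | IsOpen U}) rfl isPiSystem_isOpen key
    (key _ isOpen_univ)

theorem addRoot_eq_sum (x : RootedNet Ξ (k + 1)) :
    addRoot x = Measure.sum fun n => (addRoot x).restrict {y | rootDist 1 0 y = n} := by
  rw [← Measure.restrict_iUnion (fun m n hmn => Set.disjoint_left.2 fun y hm hn =>
      hmn (hm.symm.trans hn)) fun n => (isOpen_rootDist_eq 1 0 n).measurableSet,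
    show ⋃ n, {y : RootedNet Ξ (k + 2) | rootDist 1 0 y = n} = Set.univ from
      Set.iUnion_eq_univ_iff.2 fun y => ⟨_, rfl⟩, Measure.restrict_univ]

theorem measurable_addRoot : Measurable (addRoot : RootedNet Ξ (k + 1) → _) := by
  refine Measure.measurable_of_measurable_coe _ fun A hA => ?_
  have : ∀ x : RootedNet Ξ (k + 1), addRoot x A =
      ∑' n, (addRoot x).restrict {y | rootDist 1 0 y = n} A := fun x => by
    conv_lhs => rw [addRoot_eq_sum x]
    rw [Measure.sum_apply _ hA]
  simp only [this]
  exact Measurable.tsum fun n =>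
    (Measure.measurable_coe hA).comp (measurable_restrict_addRoot n)

theorem measurable_sumRoot {F : RootedNet Ξ (k + 2) → ℝ≥0∞} (hF : Measurable F) :
    Measurable (sumRoot F) := by
  simp only [← funext (lintegral_addRoot hF)]
  exact (Measure.measurable_lintegral hF).comp measurable_addRoot

end RootedNet

/-! ### Changing and forgetting roots. -/

namespace RootedNet

variable {Ξ : Type*} {k : ℕ}

theorem exists_mk_one (x : GStar Ξ) : ∃ (N : Network Ξ) (o : N.V), mk N ![o] = x := by
  obtain ⟨N, R, rfl⟩ := mk_surjective x
  refine ⟨N, R 0, congrArg (mk N) (funext fun i => ?_)⟩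
  rw [Subsingleton.elim i 0]; rfl

@[simp]
theorem keepRoot_mk (i : Fin k) (N : Network Ξ) (R : Fin k → N.V) :
    keepRoot i (mk N R) = mk N ![R i] := rfl

/-- Exchange the two roots. -/
def swap : GStarStar Ξ → GStarStar Ξ := reindex ![1, 0]

@[simp]
theorem swap_mk (N : Network Ξ) (u v : N.V) : swap (mk N ![u, v]) = mk N ![v, u] := by
  refine congrArg (mk N) (funext fun i => ?_)
  fin_cases i <;> rfl

variable [MetricSpace Ξ]

theorem measurable_swap : Measurable (swap : GStarStar Ξ → GStarStar Ξ) := measurable_reindex _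

theorem measurable_keepRoot (i : Fin k) : Measurable (keepRoot i : RootedNet Ξ k → GStar Ξ) := by
  convert measurable_reindex (Ξ := Ξ) ![i] using 1
  funext x
  obtain ⟨N, R, rfl⟩ := mk_surjective x
  rw [reindex_mk, keepRoot_mk]
  refine congrArg (mk N) (funext fun j => ?_)
  rw [Subsingleton.elim j 0]; rfl

theorem measurable_forget : Measurable (forget : GStar Ξ → UnrootedNet Ξ) := fun _ h => h

/-- A measurable set of rooted networks not depending on the root is a measurable set of
non-rooted networks. -/
theorem measurableSet_image_forget {A : Set (GStar Ξ)} (hA : MeasurableSet A)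
    (h : ∀ (N : Network Ξ) (o v : N.V), mk N ![o] ∈ A → mk N ![v] ∈ A) :
    forget ⁻¹' (forget '' A) = A ∧ MeasurableSet (forget '' A) := by
  have h₁ : forget ⁻¹' (forget '' A) = A := by
    refine Set.Subset.antisymm ?_ (Set.subset_preimage_image _ _)
    rintro x ⟨y, hy, hyx⟩
    obtain ⟨N, o, rfl⟩ := exists_mk_one x
    obtain ⟨N', o', rfl⟩ := exists_mk_one y
    obtain ⟨φ, hφ⟩ := Quotient.exact (s := Network.setoid Ξ) hyx
    refine h N (φ.toV o') o ?_
    rwa [← mk_eq φ hφ (R := ![o'])]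
    intro i
    rw [Subsingleton.elim i 0]; rfl
  refine ⟨h₁, ?_⟩
  change MeasurableSet (forget ⁻¹' (forget '' A))
  rwa [h₁]

/-- Absolute continuity of the laws of the non-rooted networks transfers null sets not depending
on the root. -/
theorem ae_of_map_forget {μ ν : Measure (GStar Ξ)} (hν : ν.map forget ≪ μ.map forget)
    {A : Set (GStar Ξ)} (hA : MeasurableSet A)
    (h : ∀ (N : Network Ξ) (o v : N.V), mk N ![o] ∈ A → mk N ![v] ∈ A)
    (hμ : ∀ᵐ x ∂μ, x ∈ A) : ∀ᵐ x ∂ν, x ∈ A := by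
  obtain ⟨h₁, h₂⟩ := measurableSet_image_forget hA.compl fun N o v ho hv => ho (h N v o hv)
  have h₃ : μ.map forget (forget '' Aᶜ) = 0 := by
    rw [Measure.map_apply measurable_forget h₂, h₁]
    exact hμ
  have h₄ := hν h₃
  rw [Measure.map_apply measurable_forget h₂, h₁] at h₄
  exact h₄

end RootedNet

/-! ### Mass transport sums and measurability of the Markov property. -/

section

open RootedNet

variable {Ξ : Type*}

theorem inSum_eq_sumRoot (g : GStarStar Ξ → ℝ≥0) : inSum g = sumRoot fun y => (g y : ℝ≥0∞) := by
  funext x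
  obtain ⟨N, o, rfl⟩ := exists_mk_one x
  rfl

theorem outSum_eq_sumRoot (g : GStarStar Ξ → ℝ≥0) :
    outSum g = sumRoot fun y => (g (swap y) : ℝ≥0∞) := by
  funext x
  obtain ⟨N, o, rfl⟩ := exists_mk_one x
  simp only [sumRoot_mk, swap_mk]
  rfl

theorem inSum_mk (g : GStarStar Ξ → ℝ≥0) (N : Network Ξ) (o : N.V) :
    inSum g (RootedNet.mk N ![o]) = ∑' v, (g (RootedNet.mk N ![v, o]) : ℝ≥0∞) := rfl

theorem outSum_mk (g : GStarStar Ξ → ℝ≥0) (N : Network Ξ) (o : N.V) :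
    outSum g (RootedNet.mk N ![o]) = ∑' v, (g (RootedNet.mk N ![o, v]) : ℝ≥0∞) := rfl

variable [MetricSpace Ξ]

theorem CovariantSubset.mk_mem_rootIn {S : CovariantSubset Ξ} {N : Network Ξ} {R : Fin 1 → N.V} :
    RootedNet.mk N R ∈ S.rootIn ↔ R 0 ∈ S.carrier N := by
  constructor
  · rintro ⟨N', o, h, ho⟩
    obtain ⟨φ, hφ, hR⟩ := Quotient.exact (s := Network.rootedSetoid Ξ 1) h
    rw [S.covariant φ hφ]
    exact (hR 0).symm ▸ ho
  · intro h
    refine ⟨N, R 0, congrArg (RootedNet.mk N) (funext fun i => ?_), h⟩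
    rw [Subsingleton.elim i 0]; rfl

theorem measurable_inSum {g : GStarStar Ξ → ℝ≥0} (hg : Measurable g) : Measurable (inSum g) := by
  rw [inSum_eq_sumRoot]
  exact measurable_sumRoot hg.coe_nnreal_ennreal

theorem measurable_outSum {g : GStarStar Ξ → ℝ≥0} (hg : Measurable g) :
    Measurable (outSum g) := by
  rw [outSum_eq_sumRoot]
  exact measurable_sumRoot (hg.comp measurable_swap).coe_nnreal_ennreal

/-- The indicator function of the event that the `i`-th root belongs to `S`. -/
noncomputable def CovariantSubset.ind (S : CovariantSubset Ξ) {k : ℕ} (i : Fin k) :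
    RootedNet Ξ k → ℝ≥0∞ :=
  (keepRoot i ⁻¹' S.rootIn).indicator 1

theorem CovariantSubset.measurable_ind (S : CovariantSubset Ξ) {k : ℕ} (i : Fin k) :
    Measurable (S.ind i) :=
  measurable_one.indicator (measurable_keepRoot i S.measurable)

theorem CovariantSubset.ind_mk (S : CovariantSubset Ξ) {k : ℕ} (i : Fin k) (N : Network Ξ)
    (R : Fin k → N.V) : S.ind i (RootedNet.mk N R) = (S.carrier N).indicator 1 (R i) := by
  have h : RootedNet.mk N R ∈ (keepRoot i ⁻¹' S.rootIn) ↔ R i ∈ S.carrier N := S.mk_mem_rootIn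
  by_cases hR : R i ∈ S.carrier N
  · rw [CovariantSubset.ind, Set.indicator_of_mem (h.2 hR), Set.indicator_of_mem hR]; rfl
  · rw [CovariantSubset.ind, Set.indicator_of_notMem (fun h' => hR (h.1 h')),
      Set.indicator_of_notMem hR]

theorem tsum_carrier (S : CovariantSubset Ξ) (N : Network Ξ) (f : N.V → ℝ≥0∞) :
    ∑' v : S.carrier N, f v = ∑' v, (S.carrier N).indicator 1 v * f v := by
  rw [tsum_subtype]
  refine tsum_congr fun v => ?_
  by_cases hv : v ∈ S.carrier N <;> simp [hv]

/-- The mass transport principle on `S` extends to functions that may be infinite. -/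
theorem IsProperExtension.lintegral_sumRoot {Ξ₀ : Type*} [MetricSpace Ξ₀] {ι : Ξ₀ → Ξ}
    {μ₀ : Measure (GStar Ξ₀)} {μ : Measure (GStar Ξ)} {S : CovariantSubset Ξ}
    (h : IsProperExtension ι μ₀ μ S) {F : GStarStar Ξ → ℝ≥0∞} (hF : Measurable F) :
    ∫⁻ x, sumRoot (fun y => S.ind 0 y * F (swap y)) x ∂μ =
      ∫⁻ x, sumRoot (fun y => S.ind 0 y * F y) x ∂μ := by
  -- The principle is given for finite-valued functions; `F` is split into a countable sum of such
  -- functions.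
  let f : ℕ → GStarStar Ξ → ℝ≥0 := fun n => SimpleFunc.eapproxDiff F n
  have hf : ∀ n, Measurable (f n) := fun n => (SimpleFunc.eapproxDiff F n).measurable
  have hsum : ∀ y, ∑' n, (f n y : ℝ≥0∞) = F y := SimpleFunc.tsum_eapproxDiff F hF
  have hind : Measurable (S.ind (k := 2) 0) := S.measurable_ind 0
  have h₁ : ∀ x, sumRoot (fun y => S.ind 0 y * F (swap y)) x = ∑' n, outSumOn S (f n) x := by
    intro x
    obtain ⟨N, o, rfl⟩ := exists_mk_one x
    have : ∀ n, outSumOn S (f n) (RootedNet.mk N ![o]) =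
      ∑' v, (S.carrier N).indicator 1 v * (f n (RootedNet.mk N ![o, v]) : ℝ≥0∞) := fun n =>
        tsum_carrier S N fun v => (f n (RootedNet.mk N ![o, v]) : ℝ≥0∞)
    simp only [this, sumRoot_mk, swap_mk, S.ind_mk, ← hsum, ← ENNReal.tsum_mul_left]
    exact ENNReal.tsum_comm
  have h₂ : ∀ x, sumRoot (fun y => S.ind 0 y * F y) x = ∑' n, inSumOn S (f n) x := by
    intro x
    obtain ⟨N, o, rfl⟩ := exists_mk_one x
    have : ∀ n, inSumOn S (f n) (RootedNet.mk N ![o]) =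
      ∑' v, (S.carrier N).indicator 1 v * (f n (RootedNet.mk N ![v, o]) : ℝ≥0∞) := fun n =>
        tsum_carrier S N fun v => (f n (RootedNet.mk N ![v, o]) : ℝ≥0∞)
    simp only [this, sumRoot_mk, S.ind_mk, ← hsum, ← ENNReal.tsum_mul_left]
    exact ENNReal.tsum_comm
  have h₃ : ∀ n, outSumOn S (f n) = sumRoot fun y => S.ind 0 y * (f n (swap y) : ℝ≥0∞) := by
    intro n
    funext x
    obtain ⟨N, o, rfl⟩ := exists_mk_one x
    simp only [sumRoot_mk, swap_mk, S.ind_mk]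
    exact tsum_carrier S N fun v => (f n (RootedNet.mk N ![o, v]) : ℝ≥0∞)
  have h₄ : ∀ n, inSumOn S (f n) = sumRoot fun y => S.ind 0 y * (f n y : ℝ≥0∞) := by
    intro n
    funext x
    obtain ⟨N, o, rfl⟩ := exists_mk_one x
    simp only [sumRoot_mk, S.ind_mk]
    exact tsum_carrier S N fun v => (f n (RootedNet.mk N ![v, o]) : ℝ≥0∞)
  simp only [h₁, h₂]
  rw [lintegral_tsum, lintegral_tsum]
  · exact tsum_congr fun n => h.mtp (f n) (hf n)
  · intro n
    rw [h₄]
    exact (measurable_sumRoot (hind.mul (hf n).coe_nnreal_ennreal)).aemeasurable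
  · intro n
    rw [h₃]
    exact (measurable_sumRoot
      (hind.mul ((hf n).comp measurable_swap).coe_nnreal_ennreal)).aemeasurable

/-- `T` is Markovian and charges only `S`, seen from all vertices of the network. -/
def markovianSet (S : CovariantSubset Ξ) (T : GStarStar Ξ → ℝ≥0) : Set (GStar Ξ) :=
  {x | ∀ (N : Network Ξ) (o : N.V), x = RootedNet.mk N ![o] → ∀ v : N.V,
    ∑' w : N.V, (T (RootedNet.mk N ![v, w]) : ℝ≥0∞) = 1 ∧
      ∀ w ∉ S.carrier N, T (RootedNet.mk N ![v, w]) = 0}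

/-- `T` is Markovian and charges only `S`, seen from the root. -/
def markovianAtRoot (S : CovariantSubset Ξ) (T : GStarStar Ξ → ℝ≥0) : Set (GStar Ξ) :=
  {x | outSum T x = 1 ∧
    sumRoot (fun y => (keepRoot 0 ⁻¹' S.rootInᶜ).indicator (fun y => (T (swap y) : ℝ≥0∞)) y) x = 0}

theorem mk_mem_markovianAtRoot {S : CovariantSubset Ξ} {T : GStarStar Ξ → ℝ≥0} {N : Network Ξ}
    {v : N.V} : RootedNet.mk N ![v] ∈ markovianAtRoot S T ↔
      ∑' w : N.V, (T (RootedNet.mk N ![v, w]) : ℝ≥0∞) = 1 ∧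
        ∀ w ∉ S.carrier N, T (RootedNet.mk N ![v, w]) = 0 := by
  refine and_congr Iff.rfl ?_
  rw [sumRoot_mk, ENNReal.tsum_eq_zero]
  refine forall_congr' fun w => ?_
  have h : RootedNet.mk N ![w, v] ∈ keepRoot 0 ⁻¹' S.rootInᶜ ↔ w ∉ S.carrier N :=
    not_congr S.mk_mem_rootIn
  rw [Set.indicator_apply_eq_zero, h, swap_mk, ENNReal.coe_eq_zero]

theorem measurableSet_markovianAtRoot (S : CovariantSubset Ξ) {T : GStarStar Ξ → ℝ≥0}
    (hT : Measurable T) : MeasurableSet (markovianAtRoot S T) := by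
  refine (measurable_outSum hT (measurableSet_singleton 1)).inter
    (measurable_sumRoot (Measurable.indicator ?_ ?_) (measurableSet_singleton 0))
  · exact (hT.comp measurable_swap).coe_nnreal_ennreal
  · exact measurable_keepRoot 0 S.measurable.compl

/-- The quantifier over all vertices becomes the vanishing of a sum over an additional root, which
is a measurable condition. -/
theorem markovianSet_eq (S : CovariantSubset Ξ) (T : GStarStar Ξ → ℝ≥0) :
    markovianSet S T =
      {x | sumRoot ((keepRoot 0 ⁻¹' (markovianAtRoot S T)ᶜ).indicator 1) x = 0} := by
  have key : ∀ (N : Network Ξ) (o : N.V),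
      sumRoot ((keepRoot 0 ⁻¹' (markovianAtRoot S T)ᶜ).indicator 1)
        (RootedNet.mk N ![o]) = 0 ↔
        ∀ v, RootedNet.mk N ![v] ∈ markovianAtRoot S T := by
    intro N o
    rw [sumRoot_mk, ENNReal.tsum_eq_zero]
    refine forall_congr' fun v => ?_
    have h : RootedNet.mk N ![v, o] ∈ keepRoot 0 ⁻¹' (markovianAtRoot S T)ᶜ ↔
      RootedNet.mk N ![v] ∉ markovianAtRoot S T := Iff.rfl
    rw [Set.indicator_apply_eq_zero, h]
    simp
  ext x
  constructor
  · intro hx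
    obtain ⟨N, o, rfl⟩ := exists_mk_one x
    exact (key N o).2 fun v => mk_mem_markovianAtRoot.2 (hx N o rfl v)
  · rintro hx N o rfl v
    exact mk_mem_markovianAtRoot.1 ((key N o).1 hx v)

theorem measurableSet_markovianSet (S : CovariantSubset Ξ) {T : GStarStar Ξ → ℝ≥0}
    (hT : Measurable T) : MeasurableSet (markovianSet S T) := by
  rw [markovianSet_eq]
  exact measurable_sumRoot (measurable_one.indicator (measurable_keepRoot 0
    (measurableSet_markovianAtRoot S hT).compl)) (measurableSet_singleton 0)

theorem mk_mem_markovianSet {S : CovariantSubset Ξ} {T : GStarStar Ξ → ℝ≥0} {N : Network Ξ}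
    (o v : N.V) (h : RootedNet.mk N ![o] ∈ markovianSet S T) :
    RootedNet.mk N ![v] ∈ markovianSet S T := by
  rw [markovianSet_eq] at h ⊢
  -- The sum runs over all vertices and ignores the old root, so both sides agree by definition.
  exact h

/-- Being a Markovian kernel into `S` does not depend on the root. -/
theorem IsMarkovianInto.of_map_forget {S : CovariantSubset Ξ} {T : GStarStar Ξ → ℝ≥0}
    {μ ν : Measure (GStar Ξ)} (hT : Measurable T) (h : IsMarkovianInto μ S T)
    (hν : ν.map forget ≪ μ.map forget) : IsMarkovianInto ν S T :=
  ae_of_map_forget hν (measurableSet_markovianSet S hT)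
    (fun _ o v ho => mk_mem_markovianSet o v ho) h

theorem tsum_indicator_carrier_mul_eq_one {S : CovariantSubset Ξ} {T : GStarStar Ξ → ℝ≥0}
    {N : Network Ξ}
    {v : N.V} (h : ∑' w : N.V, (T (RootedNet.mk N ![v, w]) : ℝ≥0∞) = 1 ∧
      ∀ w ∉ S.carrier N, T (RootedNet.mk N ![v, w]) = 0) :
    ∑' w, (S.carrier N).indicator 1 w * (T (RootedNet.mk N ![v, w]) : ℝ≥0∞) = 1 := by
  rw [← h.1]
  refine tsum_congr fun w => ?_
  by_cases hw : w ∈ S.carrier N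
  · simp [hw]
  · simp [hw, h.2 w hw]

end

/-! ### The kernel to the nearest vertices of `S`. -/

section

open RootedNet

variable {Ξ : Type*}

theorem inSum_indicator_eq_sumRoot (T : GStarStar Ξ → ℝ≥0) (A : Set (GStar Ξ))
    [DecidablePred (· ∈ A)] :
    inSum (fun y => if y.keepRoot 0 ∈ A then T y else 0) =
      sumRoot fun y => (T y : ℝ≥0∞) * A.indicator 1 (keepRoot 0 y) := by
  rw [inSum_eq_sumRoot]
  congr 1
  funext y
  by_cases h : keepRoot 0 y ∈ A <;> simp [h]

variable [MetricSpace Ξ]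

theorem CovariantSubset.measurableSet_rootIn (S : CovariantSubset Ξ) : MeasurableSet S.rootIn :=
  S.measurable

/-- The second root is one of the vertices of `S` closest to the first root. -/
def nearestSet (S : CovariantSubset Ξ) : Set (GStarStar Ξ) :=
  keepRoot 1 ⁻¹' S.rootIn ∩
    {y | sumRoot ((keepRoot 0 ⁻¹' S.rootIn ∩
      {z : RootedNet Ξ 3 | rootDist 0 1 z < rootDist 1 2 z}).indicator 1) y = 0}

/-- The third root `u` in the definition ranges over closer competitors in `S`; the sum vanishes
exactly when there are none. -/
theorem mk_mem_nearestSet {S : CovariantSubset Ξ} {N : Network Ξ} {o v : N.V} :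
    RootedNet.mk N ![o, v] ∈ nearestSet S ↔ v ∈ S.carrier N ∧
      ∀ u ∈ S.carrier N, N.graph.dist o v ≤ N.graph.dist o u := by
  refine and_congr S.mk_mem_rootIn ?_
  rw [Set.mem_ofPred_eq, sumRoot_mk, ENNReal.tsum_eq_zero]
  refine forall_congr' fun u => ?_
  have h : RootedNet.mk N ![u, o, v] ∈ keepRoot 0 ⁻¹' S.rootIn ∩
      {z : RootedNet Ξ 3 | rootDist 0 1 z < rootDist 1 2 z} ↔
      u ∈ S.carrier N ∧ N.graph.dist u o < N.graph.dist o v :=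
    and_congr S.mk_mem_rootIn Iff.rfl
  rw [Set.indicator_apply_eq_zero, h, SimpleGraph.dist_comm]
  simp

theorem measurableSet_nearestSet (S : CovariantSubset Ξ) : MeasurableSet (nearestSet S) := by
  refine (measurable_keepRoot 1 S.measurable).inter (measurable_sumRoot
    (measurable_one.indicator ((measurable_keepRoot 0 S.measurable).inter ?_))
    (measurableSet_singleton 0))
  exact measurableSet_lt (measurable_rootDist 0 1) (measurable_rootDist 1 2)

/-- The number of vertices of `S` closest to the root. -/
noncomputable def nearestCount (S : CovariantSubset Ξ) : GStar Ξ → ℝ≥0∞ :=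
  sumRoot fun y => (nearestSet S).indicator 1 (swap y)

/-- The transport kernel to a uniformly chosen closest vertex of `S`. -/
noncomputable def nearestKernel (S : CovariantSubset Ξ) (y : GStarStar Ξ) : ℝ≥0 :=
  ((nearestSet S).indicator 1 y / nearestCount S (keepRoot 0 y)).toNNReal

theorem measurable_nearestKernel (S : CovariantSubset Ξ) : Measurable (nearestKernel S) := by
  have h : Measurable ((nearestSet S).indicator (1 : GStarStar Ξ → ℝ≥0∞)) :=
    measurable_one.indicator (measurableSet_nearestSet S)
  exact (h.div ((measurable_sumRoot (h.comp measurable_swap)).comp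
    (measurable_keepRoot 0))).ennreal_toNNReal

theorem indicator_one_lt_top {α : Type*} (s : Set α) (a : α) :
    s.indicator (1 : α → ℝ≥0∞) a < ∞ := by
  by_cases ha : a ∈ s <;> simp [ha]

theorem nearestCount_mk (S : CovariantSubset Ξ) (N : Network Ξ) (o : N.V) :
    nearestCount S (RootedNet.mk N ![o]) =
      ∑' v, (nearestSet S).indicator 1 (RootedNet.mk N ![o, v]) := by
  simp [nearestCount]

/-- A minimal distance to `S` is attained, and all minimizers lie in one finite ball. -/
theorem nearestCount_ne_zero_ne_top {S : CovariantSubset Ξ} {N : Network Ξ}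
    (hS : (S.carrier N).Nonempty) (o : N.V) :
    nearestCount S (RootedNet.mk N ![o]) ≠ 0 ∧ nearestCount S (RootedNet.mk N ![o]) ≠ ∞ := by
  classical
  obtain ⟨w, hw, hmin⟩ := exists_minimalFor_of_wellFoundedLT (· ∈ S.carrier N)
    (N.graph.dist o) hS
  have hmin' : ∀ u ∈ S.carrier N, N.graph.dist o w ≤ N.graph.dist o u := fun u hu =>
    (le_total (N.graph.dist o w) (N.graph.dist o u)).elim id fun h => hmin hu h
  rw [nearestCount_mk]
  constructor
  · rw [Ne, ENNReal.tsum_eq_zero]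
    intro h
    have := h w
    rw [Set.indicator_of_mem (mk_mem_nearestSet.2 ⟨hw, hmin'⟩)] at this
    simp at this
  · have hfin := N.finite_dist_le o (N.graph.dist o w)
    rw [tsum_eq_sum (s := hfin.toFinset)]
    · exact (ENNReal.sum_lt_top.2 fun v _ => indicator_one_lt_top _ _).ne
    · intro v hv
      refine Set.indicator_of_notMem (fun h => hv ?_) _
      rw [Set.Finite.mem_toFinset]
      exact (mk_mem_nearestSet.1 h).2 w hw

theorem isMarkovianInto_nearestKernel {S : CovariantSubset Ξ} {μ : Measure (GStar Ξ)}
    (h : ∀ᵐ x ∂μ, x ∈ S.rootIn) : IsMarkovianInto μ S (nearestKernel S) := by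
  filter_upwards [h] with x hx
  rintro N o rfl v
  obtain ⟨h₀, h₁⟩ := nearestCount_ne_zero_ne_top ⟨o, S.mk_mem_rootIn.1 hx⟩ v
  refine ⟨?_, fun w hw => ?_⟩
  · have : ∀ w, (nearestKernel S (RootedNet.mk N ![v, w]) : ℝ≥0∞) =
        (nearestSet S).indicator 1 (RootedNet.mk N ![v, w]) *
          (nearestCount S (RootedNet.mk N ![v]))⁻¹ := fun w => by
      rw [nearestKernel, ENNReal.coe_toNNReal, ENNReal.div_eq_inv_mul, mul_comm]
      · rfl
      · exact (ENNReal.div_lt_top (indicator_one_lt_top _ _).ne h₀).ne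
    simp only [this]
    rw [ENNReal.tsum_mul_right, ← nearestCount_mk, ENNReal.mul_inv_cancel h₀ h₁]
  · rw [nearestKernel, Set.indicator_of_notMem fun h => hw (mk_mem_nearestSet.1 h).1]
    simp

/-! ### A unimodularization is determined by its conditional law. -/

open Classical in
/-- The mass transport principle computes a unimodularization from its restriction to `S`. -/
theorem IsUnimodular.measure_eq {S : CovariantSubset Ξ} {T : GStarStar Ξ → ℝ≥0}
    {ν : Measure (GStar Ξ)} (hν : IsUnimodular ν) (hT : Measurable T)
    (h : IsMarkovianInto ν S T) {A : Set (GStar Ξ)} (hA : MeasurableSet A) :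
    ν A = ∫⁻ x in S.rootIn,
      inSum (fun y => if y.keepRoot 0 ∈ A then T y else 0) x ∂ν := by
  have hg : Measurable fun y : GStarStar Ξ => if y.keepRoot 0 ∈ A then T y else 0 :=
    Measurable.ite (measurable_keepRoot 0 hA) hT measurable_const
  -- The mass sent out is the indicator of `A`, since `T` has total mass `1` from the root.
  have h₁ : ∫⁻ x, outSum (fun y => if y.keepRoot 0 ∈ A then T y else 0) x ∂ν = ν A := by
    rw [← lintegral_indicator_one hA]
    refine lintegral_congr_ae ?_
    filter_upwards [h] with x hx
    obtain ⟨N, o, rfl⟩ := exists_mk_one x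
    have hk : ∀ v, keepRoot 0 (RootedNet.mk N ![o, v]) = RootedNet.mk N ![o] := fun _ => rfl
    simp only [outSum_mk, hk]
    by_cases ho : RootedNet.mk N ![o] ∈ A
    · simp [ho, (hx N o rfl o).1]
    · simp [ho]
  -- No mass arrives outside `S`, so restricting to `S.rootIn` loses nothing.
  rw [← h₁, hν _ hg, ← lintegral_indicator S.measurableSet_rootIn]
  refine lintegral_congr_ae ?_
  filter_upwards [h] with x hx
  obtain ⟨N, o, rfl⟩ := exists_mk_one x
  by_cases ho : o ∈ S.carrier N
  · rw [Set.indicator_of_mem (S.mk_mem_rootIn.2 ho)]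
  · rw [Set.indicator_of_notMem (fun h => ho (S.mk_mem_rootIn.1 h)), inSum_mk,
      ENNReal.tsum_eq_zero]
    intro v
    simp [(hx N o rfl v).2 o ho]

/-- Conditioning on a null set yields the zero measure. Equality with a probability measure
therefore already contains the positivity of the conditioning event. -/
theorem restrict_eq_of_cond_eq {Ω : Type*} [MeasurableSpace Ω] {μ ν : Measure Ω}
    [IsProbabilityMeasure μ] [IsFiniteMeasure ν] {s : Set Ω} (h : ProbabilityTheory.cond ν s = μ) :
    ν s ≠ 0 ∧ ν.restrict s = ν s • μ := by
  have h₀ : ν s ≠ 0 := fun h₀ => by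
    have : μ = 0 := by rw [← h, ProbabilityTheory.cond, Measure.restrict_eq_zero.2 h₀, smul_zero]
    exact IsProbabilityMeasure.ne_zero μ this
  refine ⟨h₀, ?_⟩
  rw [← h, ProbabilityTheory.cond, smul_smul, ENNReal.mul_inv_cancel h₀ (measure_ne_top _ _),
    one_smul]

theorem IsUnimodularization.eq_transportLaw {S : CovariantSubset Ξ} {T : GStarStar Ξ → ℝ≥0}
    {μ ν : Measure (GStar Ξ)} [IsProbabilityMeasure μ]
    (hν : IsUnimodularization ν (μ.map RootedNet.forget))
    (hcond : ProbabilityTheory.cond ν S.rootIn = μ) (hT : Measurable T)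
    (hTS : IsMarkovianInto μ S T) :
    ∫⁻ x, inSum T x ∂μ < ∞ ∧ ∀ A, MeasurableSet A → ν A = transportLaw μ T A := by
  classical
  have := hν.isProbabilityMeasure
  have hTν := hTS.of_map_forget hT hν.absolutelyContinuous
  obtain ⟨h₀, hr⟩ := restrict_eq_of_cond_eq hcond
  have key : ∀ A, MeasurableSet A → ν A = ν S.rootIn * ∫⁻ x,
      inSum (fun y => if y.keepRoot 0 ∈ A then T y else 0) x ∂μ := fun A hA => by
    conv_lhs => rw [hν.isUnimodular.measure_eq hT hTν hA]
    rw [hr, lintegral_smul_measure, smul_eq_mul]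
  -- Taking `A` to be the whole space fixes the constant `ν S.rootIn`.
  have huniv : ν S.rootIn * ∫⁻ x, inSum T x ∂μ = 1 := by
    have := key Set.univ MeasurableSet.univ
    simp only [Set.mem_univ, if_true, measure_univ] at this
    exact this.symm
  have hinv : ν S.rootIn = (∫⁻ x, inSum T x ∂μ)⁻¹ := ENNReal.eq_inv_of_mul_eq_one_left huniv
  refine ⟨?_, fun A hA => ?_⟩
  · rw [hinv] at h₀
    exact lt_top_iff_ne_top.2 fun h => h₀ (by rw [h, ENNReal.inv_top])
  · rw [key A hA, hinv, transportLaw]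

/-! ### The transport law as a measure. -/

/-- The measure `A ↦ (1 / E[M]) E[∑_v T_G(v, o) 1_A[G, v]]`. -/
noncomputable def transportMeasure (μ : Measure (GStar Ξ)) (T : GStarStar Ξ → ℝ≥0) :
    Measure (GStar Ξ) :=
  (∫⁻ x, inSum T x ∂μ)⁻¹ •
    ((μ.bind addRoot).withDensity fun y => (T y : ℝ≥0∞)).map (keepRoot 0)

/-- The measure is the image of one on doubly-rooted networks, weighted by `T`. This gives countable
additivity and integrals of arbitrary measurable `f`, not only indicators. -/
theorem lintegral_transportMeasure (μ : Measure (GStar Ξ)) {T : GStarStar Ξ → ℝ≥0}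
    (hT : Measurable T) {f : GStar Ξ → ℝ≥0∞} (hf : Measurable f) :
    ∫⁻ x, f x ∂transportMeasure μ T = (∫⁻ x, inSum T x ∂μ)⁻¹ *
      ∫⁻ x, sumRoot (fun y => (T y : ℝ≥0∞) * f (keepRoot 0 y)) x ∂μ := by
  have hT' := hT.coe_nnreal_ennreal
  have hf' := hf.comp (measurable_keepRoot (Ξ := Ξ) (k := 2) 0)
  have h := lintegral_withDensity_eq_lintegral_mul (μ.bind addRoot) hT' hf'
  rw [Measure.lintegral_bind measurable_addRoot.aemeasurable (hT'.mul hf').aemeasurable] at h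
  simp only [lintegral_addRoot (hT'.mul hf')] at h
  rw [transportMeasure, lintegral_smul_measure, smul_eq_mul,
    lintegral_map hf (measurable_keepRoot 0)]
  exact congrArg ((∫⁻ x, inSum T x ∂μ)⁻¹ * ·) h

theorem transportMeasure_apply (μ : Measure (GStar Ξ)) {T : GStarStar Ξ → ℝ≥0}
    (hT : Measurable T) {A : Set (GStar Ξ)} (hA : MeasurableSet A) :
    transportMeasure μ T A = transportLaw μ T A := by
  classical
  rw [← lintegral_indicator_one hA,
    lintegral_transportMeasure μ hT (measurable_one.indicator hA), transportLaw,
    ← inSum_indicator_eq_sumRoot]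

/-! ### The transport law is a unimodularization with the right conditional law. -/

section ProperExtension

variable {Ξ₀ : Type*} [MetricSpace Ξ₀] {ι : Ξ₀ → Ξ} {μ₀ : Measure (GStar Ξ₀)}
  {μ : Measure (GStar Ξ)} {S : CovariantSubset Ξ} {T : GStarStar Ξ → ℝ≥0}

/-- Moving mass from outside `S` into `S` symmetrizes the mass transport. -/
theorem IsProperExtension.lintegral_transport (hext : IsProperExtension ι μ₀ μ S)
    (hT : Measurable T) (hTS : IsMarkovianInto μ S T) {g : GStarStar Ξ → ℝ≥0}
    (hg : Measurable g) :
    ∫⁻ x, sumRoot (fun y => (T y : ℝ≥0∞) * outSum g (keepRoot 0 y)) x ∂μ =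
      ∫⁻ x, sumRoot (fun y => (T y : ℝ≥0∞) * inSum g (keepRoot 0 y)) x ∂μ := by
  have hT' := hT.coe_nnreal_ennreal
  have hg' := hg.coe_nnreal_ennreal
  -- The roots are `[w, v, o, u]`. Summing out `w` and `v` gives `H(o,u)`, the `g`-mass sent from
  -- vertices allotted to `o` to vertices allotted to `u`.
  let K : RootedNet Ξ 4 → ℝ≥0∞ := fun z =>
    T (reindex ![1, 2] z) * g (reindex ![1, 0] z) * T (reindex ![0, 3] z)
  have hK : Measurable K := ((hT'.comp (measurable_reindex _)).mul
    (hg'.comp (measurable_reindex _))).mul (hT'.comp (measurable_reindex _))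
  have hKmk : ∀ (N : Network Ξ) (w v o u : N.V), K (RootedNet.mk N ![w, v, o, u]) =
      T (RootedNet.mk N ![v, o]) * g (RootedNet.mk N ![v, w]) * T (RootedNet.mk N ![w, u]) := by
    intro N w v o u
    have h : ∀ i j : Fin 4, reindex ![i, j] (RootedNet.mk N ![w, v, o, u]) =
        RootedNet.mk N ![(![w, v, o, u] : Fin 4 → N.V) i, (![w, v, o, u] : Fin 4 → N.V) j] := by
      intro i j
      refine congrArg (RootedNet.mk N) (funext fun l => ?_)
      fin_cases l <;> rfl
    simp only [K, h]
    rfl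
  let H : GStarStar Ξ → ℝ≥0∞ := sumRoot (sumRoot K)
  have hH : Measurable H := measurable_sumRoot (measurable_sumRoot hK)
  have hHmk : ∀ (N : Network Ξ) (o u : N.V), H (RootedNet.mk N ![o, u]) =
      ∑' v, ∑' w, (T (RootedNet.mk N ![v, o]) * g (RootedNet.mk N ![v, w]) *
        T (RootedNet.mk N ![w, u]) : ℝ≥0∞) := fun N o u => by
    simp only [H, sumRoot_mk, hKmk]
  -- The factor `1 = ∑ T(w,u)`, over `u` in `S`, is inserted for each `w`.
  trans ∫⁻ x, sumRoot (fun y => S.ind 0 y * H (swap y)) x ∂μ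
  · refine lintegral_congr_ae ?_
    filter_upwards [hTS] with x hx
    obtain ⟨N, o, rfl⟩ := exists_mk_one x
    simp only [sumRoot_mk, swap_mk, S.ind_mk, hHmk, ← ENNReal.tsum_mul_left]
    rw [ENNReal.tsum_comm]
    refine tsum_congr fun v => ?_
    have hk : keepRoot 0 (RootedNet.mk N ![v, o]) = RootedNet.mk N ![v] := rfl
    rw [ENNReal.tsum_comm, hk, outSum_mk, ← ENNReal.tsum_mul_left]
    refine tsum_congr fun w => ?_
    conv_lhs => rw [← mul_one (_ * _), ← tsum_indicator_carrier_mul_eq_one (hx N o rfl w),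
      ← ENNReal.tsum_mul_left]
    exact tsum_congr fun u => mul_left_comm _ _ _
  -- The transport now reads `H(u,o)`, with factors `T(v,u)` and `T(w,o)`; summing over `u` in `S`
  -- removes the first, leaving incoming sums at `w`.
  · rw [hext.lintegral_sumRoot hH]
    refine lintegral_congr_ae ?_
    filter_upwards [hTS] with x hx
    obtain ⟨N, o, rfl⟩ := exists_mk_one x
    have hk : ∀ w, keepRoot 0 (RootedNet.mk N ![w, o]) = RootedNet.mk N ![w] := fun _ => rfl
    simp only [sumRoot_mk, S.ind_mk, hHmk, hk, inSum_mk, ← ENNReal.tsum_mul_left]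
    rw [ENNReal.tsum_comm]
    conv_rhs => rw [ENNReal.tsum_comm]
    refine tsum_congr fun v => ?_
    rw [ENNReal.tsum_comm]
    refine tsum_congr fun w => ?_
    conv_rhs => rw [← mul_one (_ * _), ← tsum_indicator_carrier_mul_eq_one (hx N o rfl v),
      ← ENNReal.tsum_mul_left]
    refine tsum_congr fun u => ?_
    simp only [Matrix.cons_val_zero]
    ring

/-- On `S`, the transported measure is the original one up to normalization. -/
theorem IsProperExtension.lintegral_transport_rootIn (hext : IsProperExtension ι μ₀ μ S)
    (hT : Measurable T) (hTS : IsMarkovianInto μ S T) {f : GStar Ξ → ℝ≥0∞} (hf : Measurable f) :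
    ∫⁻ x, sumRoot (fun y => (T y : ℝ≥0∞) * S.rootIn.indicator f (keepRoot 0 y)) x ∂μ =
      ∫⁻ x, f x ∂μ := by
  have hF : Measurable fun y : GStarStar Ξ => (T y : ℝ≥0∞) * f (keepRoot 0 y) :=
    hT.coe_nnreal_ennreal.mul (hf.comp (measurable_keepRoot 0))
  trans ∫⁻ x, sumRoot (fun y => S.ind 0 y * ((T y : ℝ≥0∞) * f (keepRoot 0 y))) x ∂μ
  · refine lintegral_congr fun x => congrFun (congrArg sumRoot (funext fun y => ?_)) x
    by_cases hy : keepRoot 0 y ∈ S.rootIn <;> simp [CovariantSubset.ind, hy]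
  -- Reversing the transport leaves `f[G,o] ∑ T(o,w)` over `w` in `S`, which is `f[G,o]`.
  · rw [← hext.lintegral_sumRoot hF]
    refine lintegral_congr_ae ?_
    filter_upwards [hTS] with x hx
    obtain ⟨N, o, rfl⟩ := exists_mk_one x
    have hk : ∀ w, keepRoot 0 (RootedNet.mk N ![o, w]) = RootedNet.mk N ![o] := fun _ => rfl
    simp only [sumRoot_mk, swap_mk, S.ind_mk, hk, ← mul_assoc]
    rw [ENNReal.tsum_mul_right]
    have := tsum_indicator_carrier_mul_eq_one (hx N o rfl o)
    simp only [Matrix.cons_val_zero]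
    rw [this, one_mul]

/-- The part of `M` sent from vertices of `S` already has mean `1`. -/
theorem IsProperExtension.lintegral_inSum_ne_zero [IsProbabilityMeasure μ]
    (hext : IsProperExtension ι μ₀ μ S) (hT : Measurable T) (hTS : IsMarkovianInto μ S T) :
    ∫⁻ x, inSum T x ∂μ ≠ 0 := by
  have h := hext.lintegral_transport_rootIn hT hTS measurable_one
  simp only [Pi.one_apply, lintegral_one, measure_univ] at h
  have h' : 1 ≤ ∫⁻ x, inSum T x ∂μ := by
    rw [← h]
    refine lintegral_mono fun x => ?_
    obtain ⟨N, o, rfl⟩ := exists_mk_one x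
    rw [inSum_mk, sumRoot_mk]
    refine ENNReal.tsum_le_tsum fun v => ?_
    exact mul_le_of_le_one_right' (Set.indicator_le_self' (fun _ _ => zero_le) _)
  exact (one_pos.trans_le h').ne'

/-- On `S` the transport law is `μ` divided by `E[M]`, so conditioning cancels the constant. -/
theorem IsProperExtension.cond_transportMeasure [IsProbabilityMeasure μ]
    (hext : IsProperExtension ι μ₀ μ S) (hT : Measurable T) (hTS : IsMarkovianInto μ S T)
    (hfin : ∫⁻ x, inSum T x ∂μ < ∞) :
    ProbabilityTheory.cond (transportMeasure μ T) S.rootIn = μ := by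
  have h₀ := hext.lintegral_inSum_ne_zero hT hTS
  have key : ∀ A, MeasurableSet A → transportMeasure μ T (S.rootIn ∩ A) =
      (∫⁻ x, inSum T x ∂μ)⁻¹ * μ A := by
    intro A hA
    rw [← lintegral_indicator_one (S.measurableSet_rootIn.inter hA), lintegral_transportMeasure μ hT
      (measurable_one.indicator (S.measurableSet_rootIn.inter hA)), ← lintegral_indicator_one hA,
      ← hext.lintegral_transport_rootIn hT hTS (measurable_one.indicator hA),
      Set.indicator_indicator]
  have hS : transportMeasure μ T S.rootIn = (∫⁻ x, inSum T x ∂μ)⁻¹ := by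
    simpa using key Set.univ MeasurableSet.univ
  ext A hA
  rw [ProbabilityTheory.cond_apply S.measurableSet_rootIn, key A hA, hS, inv_inv, ← mul_assoc,
    ENNReal.mul_inv_cancel h₀ hfin.ne, one_mul]

theorem IsProperExtension.isUnimodularization_transportMeasure [IsProbabilityMeasure μ]
    (hext : IsProperExtension ι μ₀ μ S) (hT : Measurable T) (hTS : IsMarkovianInto μ S T)
    (hfin : ∫⁻ x, inSum T x ∂μ < ∞) :
    IsUnimodularization (transportMeasure μ T) (μ.map RootedNet.forget) where
  isProbabilityMeasure := by
    refine ⟨?_⟩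
    rw [← lintegral_one, lintegral_transportMeasure μ hT measurable_const]
    simp only [mul_one]
    rw [← inSum_eq_sumRoot, ENNReal.inv_mul_cancel (hext.lintegral_inSum_ne_zero hT hTS) hfin.ne]
  isUnimodular g hg := by
    rw [lintegral_transportMeasure μ hT (measurable_outSum hg),
      lintegral_transportMeasure μ hT (measurable_inSum hg), hext.lintegral_transport hT hTS hg]
  -- Transport only moves the root within the same network, so null events that ignore the root stay
  -- null.
  absolutelyContinuous := by
    refine Measure.AbsolutelyContinuous.mk fun B hB h => ?_
    rw [Measure.map_apply measurable_forget hB] at h ⊢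
    have hB' := measurable_forget hB
    rw [← lintegral_indicator_one hB',
      lintegral_transportMeasure μ hT (measurable_one.indicator hB')]
    have : ∫⁻ x, sumRoot (fun y => (T y : ℝ≥0∞) *
        (forget ⁻¹' B).indicator 1 (keepRoot 0 y)) x ∂μ = 0 := by
      refine lintegral_eq_zero_of_ae_eq_zero ?_
      have h' : ∀ᵐ x ∂μ, x ∉ forget ⁻¹' B := measure_eq_zero_iff_ae_notMem.1 h
      filter_upwards [h'] with x hx
      obtain ⟨N, o, rfl⟩ := exists_mk_one x
      rw [sumRoot_mk, Pi.zero_apply, ENNReal.tsum_eq_zero]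
      intro v
      rw [Set.indicator_of_notMem, mul_zero]
      exact hx
    rw [this, mul_zero]
  -- `μ` is a conditional law of the transport law, hence absolutely continuous with respect to it.
  absolutelyContinuous' := by
    refine Measure.AbsolutelyContinuous.map ?_ measurable_forget
    conv_lhs => rw [← hext.cond_transportMeasure hT hTS hfin]
    exact ProbabilityTheory.cond_absolutelyContinuous

end ProperExtension

end

/-! ### Assembly of the proposition. -/

theorem mainTheorem12 {Ξ₀ Ξ : Type*}
    [MetricSpace Ξ₀] [CompleteSpace Ξ₀] [SeparableSpace Ξ₀]
    [MetricSpace Ξ] [CompleteSpace Ξ] [SeparableSpace Ξ]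
    (ι : Ξ₀ → Ξ) (hι : Isometry ι)
    (μ₀ : Measure (GStar Ξ₀)) [IsProbabilityMeasure μ₀] (hμ₀ : IsUnimodular μ₀)
    (μ : Measure (GStar Ξ)) [IsProbabilityMeasure μ]
    (S : CovariantSubset Ξ) (hext : IsProperExtension ι μ₀ μ S) :
    -- at most one unimodularization recovers the law `μ` by conditioning
    (∀ ν ν' : Measure (GStar Ξ),
      IsUnimodularization ν (μ.map RootedNet.forget) → ProbabilityTheory.cond ν S.rootIn = μ →
      IsUnimodularization ν' (μ.map RootedNet.forget) → ProbabilityTheory.cond ν' S.rootIn = μ →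
      ν = ν') ∧
    -- given a Markovian transport kernel into `S`
    (∀ T : GStarStar Ξ → ℝ≥0, Measurable T → IsMarkovianInto μ S T →
      ((∃ ν : Measure (GStar Ξ), IsUnimodularization ν (μ.map RootedNet.forget) ∧
          ProbabilityTheory.cond ν S.rootIn = μ) ↔ ∫⁻ x, inSum T x ∂μ < ∞) ∧
      (∀ ν : Measure (GStar Ξ),
        (IsUnimodularization ν (μ.map RootedNet.forget) ∧
          ProbabilityTheory.cond ν S.rootIn = μ) ↔
        (∫⁻ x, inSum T x ∂μ < ∞ ∧
          ∀ A : Set (GStar Ξ), MeasurableSet A → ν A = transportLaw μ T A))) := by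
  have hchar : ∀ T : GStarStar Ξ → ℝ≥0, Measurable T → IsMarkovianInto μ S T →
      ∀ ν : Measure (GStar Ξ),
        (IsUnimodularization ν (μ.map RootedNet.forget) ∧
          ProbabilityTheory.cond ν S.rootIn = μ) ↔
        (∫⁻ x, inSum T x ∂μ < ∞ ∧
          ∀ A : Set (GStar Ξ), MeasurableSet A → ν A = transportLaw μ T A) := by
    intro T hT hTS ν
    refine ⟨fun h => h.1.eq_transportLaw h.2 hT hTS, fun ⟨hfin, h⟩ => ?_⟩
    obtain rfl : ν = transportMeasure μ T :=
      Measure.ext fun A hA => by rw [h A hA, transportMeasure_apply μ hT hA]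
    exact ⟨hext.isUnimodularization_transportMeasure hT hTS hfin,
      hext.cond_transportMeasure hT hTS hfin⟩
  refine ⟨fun ν ν' hν hc hν' hc' => ?_, fun T hT hTS => ⟨⟨?_, fun hfin => ?_⟩, hchar T hT hTS⟩⟩
  -- Uniqueness comes without a kernel, so `nearestKernel S` is used; both measures equal its
  -- transport law.
  · have hK := hchar _ (measurable_nearestKernel S)
      (isMarkovianInto_nearestKernel hext.root_mem)
    exact Measure.ext fun A hA => by
      rw [((hK ν).1 ⟨hν, hc⟩).2 A hA, ((hK ν').1 ⟨hν', hc'⟩).2 A hA]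
  · rintro ⟨ν, hν⟩
    exact ((hchar T hT hTS ν).1 hν).1
  · exact ⟨transportMeasure μ T, hext.isUnimodularization_transportMeasure hT hTS hfin,
      hext.cond_transportMeasure hT hTS hfin⟩
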